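/- Let $A$ be a separable unital $C^*$-algebra, let $n\ge 1$ be an integer, and let $\alpha\colon\mathbb{T}\to\mathrm{Aut}(A)$ be an action of the circle group that is continuous for the topology of pointwise norm convergence on $\mathrm{Aut}(A)$. Suppose that $\alpha$ has the Rokhlin property: for every finite set $F\subseteq A$ and every $\varepsilon>0$ there is a unitary $u\in A$ such that $\|\alpha_\zeta(u)-\zeta u\|<\varepsilon$ for all $\zeta\in\mathbb{T}$ and $\|ua-au\|<\varepsilon$ for all $a\in F$. Suppose moreover that $A$ absorbs the UHF algebra $M_{n^\infty}=\varinjlim_k\,(M_{n^k},\,x\mapsto x\otimes 1_{M_n})$, that is, $A\cong A\otimes M_{n^\infty}$. Regard $\mathbb{Z}_n$ as the subgroup of $n$-th roots of unity in $\mathbb{T}$, with $k\in\mathbb{Z}_n$ corresponding to $e^{2\pi i k/n}$. Then the restriction $\alpha|_{\mathbb{Z}_n}\colon\mathbb{Z}_n\to\mathrm{Aut}(A)$ has the Rokhlin property: for every finite set $F\subseteq A$ and every $\varepsilon>0$ there are pairwise orthogonal projections $e_g\in A$, for $g\in\mathbb{Z}_n$, such that 1. $\|\alpha_g(e_h)-e_{gh}\|<\varepsilon$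 for all $g,h\in\mathbb{Z}_n$ (the group being written multiplicatively), 2. $\|e_g a-a e_g\|<\varepsilon$ for all $g\in\mathbb{Z}_n$ and all $a\in F$, and 3. $\sum_{g\in\mathbb{Z}_n}e_g=1$. -/

import Mathlib

open scoped TensorProduct

noncomputable section

namespace RokhlinCircle

/-! ### The UHF algebra `M_{n^∞}` -/

/-- The Hilbert space `ℓ²` over the set of all infinite words in the alphabet `{0, …, n-1}`. -/
abbrev WordSpace (n : ℕ) : Type := lp (fun _ : ℕ → Fin n => ℂ) 2

/-- The entries of `e_{ij}^{(k)} ξ`: at a word `w` with `k`-th letter `i` it is the value of `ξ` at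
the word obtained from `w` by replacing the `k`-th letter by `j`; elsewhere it is zero. -/
def siteFun (n k : ℕ) (i j : Fin n) (ξ : (ℕ → Fin n) → ℂ) (w : ℕ → Fin n) : ℂ :=
  if w k = i then ξ (Function.update w k j) else 0

theorem siteFun_bound (n k : ℕ) (i j : Fin n) (ξ : WordSpace n) (s : Finset (ℕ → Fin n)) :
    ∑ w ∈ s, ‖siteFun n k i j ξ w‖ ^ (2 : ENNReal).toReal ≤ ‖ξ‖ ^ (2 : ENNReal).toReal := by
  classical
  have h2 : 0 < (2 : ENNReal).toReal := by norm_num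
  have hinj : Set.InjOn (fun w : ℕ → Fin n => Function.update w k j)
      (s.filter fun w => w k = i : Finset (ℕ → Fin n)) := by
    intro v hv w hw h
    simp only [Finset.coe_filter, Set.mem_ofPred_eq] at hv hw
    funext l
    by_cases hl : l = k
    · subst hl; rw [hv.2, hw.2]
    · simpa [hl] using congrFun h l
  calc ∑ w ∈ s, ‖siteFun n k i j ξ w‖ ^ (2 : ENNReal).toReal
      = ∑ w ∈ s.filter (fun w => w k = i),
          ‖ξ (Function.update w k j)‖ ^ (2 : ENNReal).toReal := by
        rw [Finset.sum_filter]
        refine Finset.sum_congr rfl fun w _ => ?_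
        by_cases h : w k = i <;> simp [siteFun, h]
    _ = ∑ v ∈ (s.filter fun w => w k = i).image (fun w => Function.update w k j),
          ‖ξ v‖ ^ (2 : ENNReal).toReal := by
        exact (Finset.sum_image (f := fun v => ‖ξ v‖ ^ (2 : ENNReal).toReal) hinj).symm
    _ ≤ ‖ξ‖ ^ (2 : ENNReal).toReal := lp.sum_rpow_le_norm_rpow h2 ξ _

/-- The matrix unit `e_{ij}` of `M_n`, acting on the `k`-th letter, as a bounded operator: it maps
the basis vector of a word `w` to that of the word with `k`-th letter `i` if the `k`-th letter of
`w` is `j`, and to `0` otherwise. -/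
def siteUnit (n k : ℕ) (i j : Fin n) : WordSpace n →L[ℂ] WordSpace n :=
  LinearMap.mkContinuous
    { toFun := fun ξ => ⟨siteFun n k i j ξ, memℓp_gen' (siteFun_bound n k i j ξ)⟩
      map_add' := by
        intro ξ η
        ext w
        change siteFun n k i j (ξ + η : WordSpace n) w = siteFun n k i j ξ w + siteFun n k i j η w
        by_cases h : w k = i <;> simp [siteFun, h]
      map_smul' := by
        intro c ξ
        ext w
        by_cases h : w k = i <;> simp [siteFun, h] }
    1 (by
      intro ξ
      rw [one_mul]
      exact lp.norm_le_of_forall_sum_le (by norm_num) (norm_nonneg ξ) (siteFun_bound n k i j ξ))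

/-- The UHF algebra `M_{n^∞} = M_n ⊗ M_n ⊗ ⋯`, realised on `ℓ²` of the infinite words: the
operators `e_{ij}^{(k)}` with `k < m` generate a copy of `M_{n^m} = M_n ⊗ ⋯ ⊗ M_n` (`m` factors),
these copies increase with `m` along the unital inclusions `x ↦ x ⊗ 1`, and `M_{n^∞}` is the norm
closure of their union. -/
def uhfSubalgebra (n : ℕ) : StarSubalgebra ℂ (WordSpace n →L[ℂ] WordSpace n) :=
  (StarAlgebra.adjoin ℂ
    {T | ∃ (k : ℕ) (i j : Fin n), T = siteUnit n k i j}).topologicalClosure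

/-- The C*-algebra `M_{n^∞}`. -/
abbrev UHF (n : ℕ) : Type := uhfSubalgebra n

instance (n : ℕ) : IsClosed (uhfSubalgebra n : Set (WordSpace n →L[ℂ] WordSpace n)) :=
  StarSubalgebra.isClosed_topologicalClosure _

instance (n : ℕ) : CStarAlgebra (UHF n) := StarSubalgebra.cstarAlgebra (uhfSubalgebra n)

/-! ### Tensor products and absorption -/

/-- The unital C*-algebra `C`, with the maps `i : A → C` (`a ↦ a ⊗ 1`) and `j : B → C`
(`b ↦ 1 ⊗ b`), is a C*-tensor product of `A` and `B`, that is, the completion of the algebraic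
tensor product of `A` and `B` in some C*-norm. If `A` or `B` is nuclear, there is only one C*-norm
on the algebraic tensor product, and `C` is the tensor product `A ⊗ B`. -/
structure IsCStarTensorProduct {A B C : Type*} [CStarAlgebra A] [CStarAlgebra B] [CStarAlgebra C]
    (i : A →⋆ₐ[ℂ] C) (j : B →⋆ₐ[ℂ] C) : Prop where
  commute : ∀ a b, Commute (i a) (j b)
  injective : Function.Injective
    (Algebra.TensorProduct.lift i.toAlgHom j.toAlgHom commute : A ⊗[ℂ] B →ₐ[ℂ] C)
  denseRange : DenseRange
    (Algebra.TensorProduct.lift i.toAlgHom j.toAlgHom commute : A ⊗[ℂ] B →ₐ[ℂ] C)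

/-- `A` absorbs `M_{n^∞}`, that is, `A ≅ A ⊗ M_{n^∞}`: the C*-algebra `A` itself carries the
structure of a tensor product of `A` and the nuclear C*-algebra `M_{n^∞}`. -/
def AbsorbsUHF (n : ℕ) (A : Type*) [CStarAlgebra A] : Prop :=
  ∃ (i : A →⋆ₐ[ℂ] A) (j : UHF n →⋆ₐ[ℂ] A), IsCStarTensorProduct i j

/-! ### Actions and Rokhlin properties -/

/-- Continuity of `α : G → Aut(A)` for the topology of pointwise norm convergence on `Aut(A)`. -/
def IsContinuousAction {G A : Type*} [Group G] [TopologicalSpace G] [CStarAlgebra A]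
    (α : G →* (A ≃⋆ₐ[ℂ] A)) : Prop :=
  ∀ a : A, Continuous fun g => α g a

/-- The Rokhlin property for a circle action. -/
def CircleRokhlin {A : Type*} [CStarAlgebra A] (α : Circle →* (A ≃⋆ₐ[ℂ] A)) : Prop :=
  ∀ (F : Finset A) (ε : ℝ), 0 < ε → ∃ u ∈ unitary A,
    (∀ ζ : Circle, ‖α ζ u - (ζ : ℂ) • u‖ < ε) ∧ ∀ a ∈ F, ‖u * a - a * u‖ < ε

/-- The Rokhlin property for an action of a finite group. -/
def FiniteRokhlin {G A : Type*} [Group G] [Fintype G] [CStarAlgebra A]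
    (β : G →* (A ≃⋆ₐ[ℂ] A)) : Prop :=
  ∀ (F : Finset A) (ε : ℝ), 0 < ε → ∃ e : G → A,
    (∀ g, IsStarProjection (e g)) ∧ (∀ g h, g ≠ h → e g * e h = 0) ∧
    (∀ g h, ‖β g (e h) - e (g * h)‖ < ε) ∧
    (∀ g, ∀ a ∈ F, ‖e g * a - a * e g‖ < ε) ∧
    ∑ g, e g = 1

/-- The restriction of a circle action to `ℤ_n`, where `k ∈ ℤ_n` is identified with the `n`-th root
of unity `exp(2πik/n)`. -/
def restrictCyclic {A : Type*} [CStarAlgebra A] (α : Circle →* (A ≃⋆ₐ[ℂ] A)) (n : ℕ) [NeZero n] :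
    Multiplicative (ZMod n) →* (A ≃⋆ₐ[ℂ] A) :=
  α.comp (ZMod.toCircle (N := n)).toMonoidHom

end RokhlinCircle

end

open scoped TensorProduct

noncomputable section

namespace RokhlinCircle

open Filter Topology

/-! A Rokhlin unitary `u` behaves asymptotically like the coordinate function `z` on the circle: it
is almost central and the action scales it. Hence `f ↦ f(u)`, sending `a z^k` to `a u^k`, is an
asymptotically multiplicative and contractive map from `C(𝕋, A)` to `A`, under which `α_ζ`
corresponds to `f ↦ α_ζ(f(ζ ·))`. It therefore suffices to find an exact equivariant partition of
unity by projections in `C(𝕋, A)`.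

Absorption supplies matrix units of `M_n` in `A` that asymptotically commute with `A`. Let `P(c)` be
the projection onto the line of `(1, c, …, c^(n-1))`. As `ω` runs through the `n`-th roots of unity,
the vectors for `c = ωz` are orthogonal, so the `P(ωz)` sum to one. Setting `f_g(z) = α_{z⁻¹}(P(ω_g
z))` makes the family exactly equivariant (`exists_equivariant_projections`).

Contractivity is the analytic point: `HasSymbol.eventually_norm_le` compares `f(u)` with a
discretised Fejér mean, which is contractive at every unitary. Then `exists_almost_projections`
carries the family to `A` with small errors, and `eventually_exists_isStarProjection` corrects it to
an exact partition by functional calculus. -/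

/-- This is Cauchy–Schwarz in the Hilbert module `A^κ` for the vectors `(b_j*)` and `(b_j* y_j)`;
the second is controlled by `b* y y* b ≤ c² b* b`. -/
theorem norm_sum_star_mul_mul_le {A κ : Type*} [CStarAlgebra A] [Fintype κ] (b y : κ → A) {c : ℝ}
    (hc : 0 ≤ c) (hy : ∀ j, ‖y j‖ ≤ c) :
    ‖∑ j, star (b j) * y j * b j‖ ≤ c * ‖∑ j, star (b j) * b j‖ := by
  let _ : PartialOrder A := CStarAlgebra.spectralOrder A
  have : StarOrderedRing A := CStarAlgebra.spectralOrderedRing A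
  let V : WithCStarModule A (κ → A) := (WithCStarModule.equiv A (κ → A)).symm fun j => star (b j)
  let W : WithCStarModule A (κ → A) := (WithCStarModule.equiv A (κ → A)).symm fun j => star (b j) * y j
  have hVW : inner A V W = ∑ j, star (b j) * y j * b j := by
    simp [V, W, WithCStarModule.pi_inner, WithCStarModule.inner_def]
  have hV : ‖V‖ ^ 2 = ‖∑ j, star (b j) * b j‖ := by
    simp [V, WithCStarModule.pi_norm_sq, WithCStarModule.inner_def]
  have hW : ‖W‖ ^ 2 ≤ c ^ 2 * ‖∑ j, star (b j) * b j‖ := by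
    rw [WithCStarModule.pi_norm_sq]
    have hle : ∑ j, inner A (W j) (W j) ≤ (c ^ 2) • ∑ j, star (b j) * b j := by
      rw [Finset.smul_sum]
      refine Finset.sum_le_sum fun j _ => ?_
      have h1 : inner A (W j) (W j) = star (b j) * (y j * star (y j)) * b j := by
        simp [W, WithCStarModule.inner_def, mul_assoc]
      rw [h1]
      refine (CStarAlgebra.star_left_conjugate_le_norm_smul (.mul_star_self _)).trans ?_
      refine smul_le_smul_of_nonneg_right ?_ (star_mul_self_nonneg _)
      rw [CStarRing.norm_self_mul_star, ← sq]
      gcongr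
      exact hy j
    refine (CStarAlgebra.norm_le_norm_of_nonneg_of_le
      (Finset.sum_nonneg fun j _ => CStarModule.inner_self_nonneg) hle).trans ?_
    rw [norm_smul, Real.norm_of_nonneg (sq_nonneg c)]
  have hW' : ‖W‖ ≤ c * ‖V‖ := by
    refine abs_le_of_sq_le_sq' (by rw [mul_pow, hV]; exact hW) ?_ |>.2
    exact mul_nonneg hc (CStarModule.norm_nonneg A)
  rw [← hVW, ← hV]
  refine (CStarModule.norm_inner_le _).trans ?_
  nlinarith [CStarModule.norm_nonneg A (x := V)]

/-! ### Asymptotic symbol calculus for trigonometric polynomials -/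

section Symbols

variable {A ι : Type*} [CStarAlgebra A] {l : Filter ι} {u : ι → unitary A}

theorem tendsto_zero_unitary_mul {X : ι → A} (hX : Tendsto X l (𝓝 0)) (g : ι → unitary A) :
    Tendsto (fun i => (g i : A) * X i) l (𝓝 0) := by
  rw [tendsto_zero_iff_norm_tendsto_zero] at hX ⊢
  simpa only [CStarRing.norm_coe_unitary_mul] using hX

theorem tendsto_zero_mul_unitary {X : ι → A} (hX : Tendsto X l (𝓝 0)) (g : ι → unitary A) :
    Tendsto (fun i => X i * (g i : A)) l (𝓝 0) := by
  rw [tendsto_zero_iff_norm_tendsto_zero] at hX ⊢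
  simpa only [CStarRing.norm_mul_coe_unitary] using hX

/-- The families of unitaries that asymptotically commute with `b`. -/
def asymptoticCommutant (l : Filter ι) (b : A) : Subgroup (ι → unitary A) where
  carrier := {g | Tendsto (fun i => (g i : A) * b - b * g i) l (𝓝 0)}
  one_mem' := by simpa using tendsto_const_nhds
  mul_mem' := by
    intro g h hg hh
    have := (tendsto_zero_unitary_mul hh g).add (tendsto_zero_mul_unitary hg h)
    rw [add_zero] at this
    refine this.congr fun i => ?_
    simp only [Pi.mul_apply, Submonoid.coe_mul]
    noncomm_ring
  inv_mem' := by
    intro g hg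
    have := (tendsto_zero_mul_unitary (tendsto_zero_unitary_mul hg g⁻¹) g⁻¹).neg
    rw [neg_zero] at this
    refine this.congr fun i => ?_
    have h1 : ((g⁻¹ i : unitary A) : A) * g i = 1 := by simp [← Submonoid.coe_mul]
    have h2 : (g i : A) * (g⁻¹ i : unitary A) = 1 := by simp [← Submonoid.coe_mul]
    rw [mul_sub, sub_mul, ← mul_assoc _ (g i : A) b, h1, mul_assoc _ (b * _), mul_assoc b, h2]
    simp

/-- The pairs of a family of unitaries and a scalar `ζ` such that `β` asymptotically multiplies the
family by `ζ`. -/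
def asymptoticEigenpairs (l : Filter ι) (β : A ≃⋆ₐ[ℂ] A) :
    Subgroup ((ι → unitary A) × Circle) where
  carrier := {p | Tendsto (fun i => β (p.1 i) - (p.2 : ℂ) • (p.1 i : A)) l (𝓝 0)}
  one_mem' := by simpa using tendsto_const_nhds
  mul_mem' := by
    rintro ⟨g, ζ⟩ ⟨h, ξ⟩ hg hh
    have := (tendsto_zero_unitary_mul hh fun i => ⟨β (g i), Unitary.map_mem β (g i).2⟩).add
      ((tendsto_zero_mul_unitary hg h).const_smul (ξ : ℂ))
    rw [smul_zero, add_zero] at this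
    refine this.congr fun i => ?_
    simp [mul_sub, sub_mul, smul_sub, smul_smul, mul_comm]
  inv_mem' := by
    rintro ⟨g, ζ⟩ hg
    have := ((tendsto_zero_mul_unitary (tendsto_zero_unitary_mul hg fun i =>
      ⟨β (g⁻¹ i), Unitary.map_mem β (g⁻¹ i).2⟩) g⁻¹).const_smul ((ζ⁻¹ : Circle) : ℂ)).neg
    rw [smul_zero, neg_zero] at this
    refine this.congr fun i => ?_
    have h1 : β ((g⁻¹ i : unitary A) : A) * β (g i) = 1 := by
      simp [← map_mul, ← Submonoid.coe_mul]
    have h2 : (g i : A) * (g⁻¹ i : unitary A) = 1 := by simp [← Submonoid.coe_mul]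
    have h3 : ((ζ⁻¹ : Circle) : ℂ) * (ζ : ℂ) = 1 := by simp
    change -(((ζ⁻¹ : Circle) : ℂ) • (β ((g⁻¹ i : unitary A) : A) * (β (g i) - (ζ : ℂ) • (g i : A)) *
      (g⁻¹ i : unitary A))) = β ((g⁻¹ i : unitary A) : A) -
        ((ζ⁻¹ : Circle) : ℂ) • ((g⁻¹ i : unitary A) : A)
    rw [mul_sub, sub_mul, h1, mul_smul_comm, smul_mul_assoc, mul_assoc _ (g i : A), h2, smul_sub,
      smul_smul, h3]
    simp

/-- `X` is asymptotically the value at the unitaries `u` of the trigonometric polynomial `f` with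
coefficients in `A`. -/
inductive HasSymbol (l : Filter ι) (u : ι → unitary A) : (Circle → A) → (ι → A) → Prop
  | monomial (k : ℤ) (a : A) :
      HasSymbol l u (fun z => ((z ^ k : Circle) : ℂ) • a) (fun i => a * (u i ^ k : unitary A))
  | add {f g : Circle → A} {X Y : ι → A} : HasSymbol l u f X → HasSymbol l u g Y →
      HasSymbol l u (f + g) (X + Y)
  | congr {f : Circle → A} {X Y : ι → A} : HasSymbol l u f X → Tendsto (Y - X) l (𝓝 0) →
      HasSymbol l u f Y

namespace HasSymbol

variable {f g : Circle → A} {X Y : ι → A}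

theorem const (a : A) : HasSymbol l u (fun _ => a) (fun _ => a) := by
  simpa using monomial (l := l) (u := u) 0 a

theorem sum {κ : Type*} (s : Finset κ) {f : κ → Circle → A} {X : κ → ι → A}
    (h : ∀ j ∈ s, HasSymbol l u (f j) (X j)) :
    HasSymbol l u (∑ j ∈ s, f j) (∑ j ∈ s, X j) := by
  classical
  induction s using Finset.induction_on with
  | empty => exact const 0
  | insert j s hj ih =>
    rw [Finset.sum_insert hj, Finset.sum_insert hj]
    exact (h j (by simp)).add (ih fun k hk => h k (by simp [hk]))

theorem isBoundedUnder (h : HasSymbol l u f X) : IsBoundedUnder (· ≤ ·) l (norm ∘ X) := by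
  induction h with
  | monomial k a =>
    exact isBoundedUnder_of ⟨‖a‖, fun i => by simp [CStarRing.norm_mul_coe_unitary]⟩
  | add _ _ ih1 ih2 =>
    obtain ⟨C, hC⟩ := ih1
    obtain ⟨D, hD⟩ := ih2
    refine ⟨C + D, ?_⟩
    rw [eventually_map] at *
    filter_upwards [hC, hD] with i h1 h2
    exact (norm_add_le _ _).trans (add_le_add h1 h2)
  | congr _ hXY ih =>
    obtain ⟨C, hC⟩ := ih
    refine ⟨1 + C, ?_⟩
    rw [eventually_map] at *
    filter_upwards [hC, hXY.norm.eventually_le_const (by simp : ‖(0 : A)‖ < 1)] with i h1 h2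
    simpa using (norm_add_le _ _).trans (add_le_add h2 h1)

/-- On monomials, `(a u^k)(b u^m)` and `ab u^(k+m)` differ by `a [u^k, b] u^m`, which tends to zero.
Boundedness of the families lets null errors pass through products. -/
theorem mul (hu : ∀ b : A, Tendsto (fun i => (u i : A) * b - b * u i) l (𝓝 0))
    (hf : HasSymbol l u f X) (hg : HasSymbol l u g Y) : HasSymbol l u (f * g) (X * Y) := by
  induction hf with
  | add _ _ ih1 ih2 => rw [add_mul, add_mul]; exact ih1.add ih2
  | congr _ hXY ih =>
    refine ih.congr ?_
    rw [← sub_mul]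
    exact hXY.zero_mul_isBoundedUnder_le hg.isBoundedUnder
  | monomial k a =>
    induction hg with
    | add _ _ ih1 ih2 => rw [mul_add, mul_add]; exact ih1.add ih2
    | congr _ hXY ih =>
      refine ih.congr ?_
      rw [← mul_sub]
      exact isBoundedUnder_le_mul_tendsto_zero (monomial k a).isBoundedUnder hXY
    | monomial m b =>
      have h := monomial (l := l) (u := u) (k + m) (a * b)
      -- Because the asymptotic commutant is a subgroup, the hypothesis on `u` passes to all integer
      -- powers.
      have hc : Tendsto (fun i => ((u i ^ k : unitary A) : A) * b - b * (u i ^ k : unitary A)) l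
          (𝓝 0) := zpow_mem (K := asymptoticCommutant l b) (hu b) k
      have h0 := (tendsto_zero_mul_unitary hc fun i => u i ^ m).const_mul a
      rw [mul_zero] at h0
      convert h.congr (Y := (fun i => a * (u i ^ k : unitary A)) *
        fun i => b * (u i ^ m : unitary A)) (h0.congr fun i => ?_) using 1
      · ext z
        simp [zpow_add, smul_smul, mul_comm]
      · simp only [zpow_add, Submonoid.coe_mul, Pi.mul_apply, Pi.sub_apply]
        noncomm_ring

theorem star (hu : ∀ b : A, Tendsto (fun i => (u i : A) * b - b * u i) l (𝓝 0))
    (hf : HasSymbol l u f X) : HasSymbol l u (star f) (star X) := by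
  induction hf with
  | add _ _ ih1 ih2 => rw [star_add, star_add]; exact ih1.add ih2
  | congr _ hXY ih =>
    refine ih.congr ?_
    rw [← star_sub]
    have := (continuous_star.tendsto (0 : A)).comp hXY
    rwa [star_zero] at this
  | monomial k a =>
    have h := monomial (l := l) (u := u) (-k) (Star.star a)
    have hc : Tendsto (fun i => ((u i ^ (-k) : unitary A) : A) * Star.star a -
      Star.star a * (u i ^ (-k) : unitary A)) l (𝓝 0) :=
      zpow_mem (K := asymptoticCommutant l (Star.star a)) (hu _) (-k)
    convert h.congr (hc.congr fun i => ?_) using 1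
    · ext z
      simp [← Circle.coe_inv_eq_conj]
    · have hk : Star.star ((u i ^ k : unitary A) : A) = (u i ^ (-k) : unitary A) := by
        rw [zpow_neg, ← Unitary.coe_star, Unitary.star_eq_inv]
      simp only [Pi.star_apply, Pi.sub_apply, star_mul, hk]

/-- Since `β(u) ≈ ζu`, the monomial `a u^k` goes to approximately `ζ^k β(a) u^k`: the map `β` acts
on coefficients and rotates the variable by `ζ`. -/
theorem map {β : A ≃⋆ₐ[ℂ] A} {ζ : Circle}
    (hβ : Tendsto (fun i => β (u i) - (ζ : ℂ) • (u i : A)) l (𝓝 0))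
    (hf : HasSymbol l u f X) :
    HasSymbol l u (fun z => β (f (ζ * z))) (fun i => β (X i)) := by
  induction hf with
  | add _ _ ih1 ih2 =>
    convert ih1.add ih2 using 1 <;> ext <;> simp
  | congr _ hXY ih =>
    refine ih.congr ?_
    rw [tendsto_zero_iff_norm_tendsto_zero] at hXY ⊢
    refine hXY.congr fun i => ?_
    simp [← map_sub, StarAlgEquiv.norm_map]
  | monomial k a =>
    have h := monomial (l := l) (u := u) k (((ζ ^ k : Circle) : ℂ) • β a)
    have hc : Tendsto (fun i => β ((u i ^ k : unitary A) : A) -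
      ((ζ ^ k : Circle) : ℂ) • ((u i ^ k : unitary A) : A)) l (𝓝 0) :=
      zpow_mem (K := asymptoticEigenpairs l β) (x := (u, ζ)) hβ k
    have h0 := hc.const_mul (β a)
    rw [mul_zero] at h0
    convert h.congr (Y := fun i => β (a * (u i ^ k : unitary A))) (h0.congr fun i => ?_) using 1
    · ext z
      simp [mul_zpow, smul_smul, mul_comm]
    · simp [mul_sub]

end HasSymbol

end Symbols

theorem sum_toCircle_zpow (N : ℕ) [NeZero N] (t : ℤ) :
    ∑ j : ZMod N, ((ZMod.toCircle j ^ t : Circle) : ℂ) = if (N : ℤ) ∣ t then (N : ℂ) else 0 := by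
  have h := AddChar.sum_mulShift (t : ZMod N) (ZMod.isPrimitive_stdAddChar N)
  rw [ZMod.card, Nat.cast_ite, Nat.cast_zero] at h
  simp only [ZMod.intCast_zmod_eq_zero_iff_dvd] at h
  rw [← h]
  refine Finset.sum_congr rfl fun j _ => ?_
  rw [ZMod.stdAddChar_apply, ← AddChar.map_zsmul_eq_zpow, zsmul_eq_mul, mul_comm]

/-! ### Discretised Fejér means and asymptotic contractivity -/

section Fejer

variable {A ι : Type*} [CStarAlgebra A] {l : Filter ι} {u : ι → unitary A}

/-- The Dirichlet kernel of order `m`, with frequencies `0, …, m - 1`, at the unitary `w`,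
translated by `z`. -/
def dirichlet (m : ℕ) (w : unitary A) (z : Circle) : A :=
  ∑ k ∈ Finset.range m, ((z ^ (-k : ℤ) : Circle) : ℂ) • ((w ^ (k : ℤ) : unitary A) : A)

/-- The Fejér mean of order `m` of `f` at the unitary `w`, discretised at the `N`-th roots of
unity. -/
def fejer (m N : ℕ) [NeZero N] (w : unitary A) (f : Circle → A) : A :=
  ((m * N : ℝ)⁻¹ : ℂ) • ∑ j : ZMod N, star (dirichlet m w (ZMod.toCircle j)) *
    f (ZMod.toCircle j) * dirichlet m w (ZMod.toCircle j)

theorem star_dirichlet (m : ℕ) (w : unitary A) (z : Circle) :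
    star (dirichlet m w z) =
      ∑ k ∈ Finset.range m, ((z ^ (k : ℤ) : Circle) : ℂ) • ((w ^ (-k : ℤ) : unitary A) : A) := by
  simp only [dirichlet, star_sum]
  refine Finset.sum_congr rfl fun k _ => ?_
  rw [star_smul, ← Unitary.coe_star, Unitary.star_eq_inv, ← zpow_neg]
  congr 1
  simp [← Circle.coe_inv_eq_conj]

/-- Expanding both kernels, the sum over the roots of unity keeps only the pairs with `p ≡ k + r`
modulo `N`. -/
theorem sum_star_dirichlet_mul_mul (m N : ℕ) [NeZero N] (w : unitary A) (r : ℤ) (a : A)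
    (hN : m + r.natAbs < N) :
    ∑ j : ZMod N, star (dirichlet m w (ZMod.toCircle j)) *
      (((ZMod.toCircle j ^ r : Circle) : ℂ) • a) * dirichlet m w (ZMod.toCircle j) =
    (N : ℂ) • ∑ k ∈ Finset.range m, ∑ p ∈ Finset.range m,
      if (p : ℤ) = k + r then ((w ^ (-k : ℤ) : unitary A) : A) * a * (w ^ (p : ℤ) : unitary A)
      else 0 := by
  have h1 : ∀ z : Circle, star (dirichlet m w z) * (((z ^ r : Circle) : ℂ) • a) * dirichlet m w z =
      ∑ k ∈ Finset.range m, ∑ p ∈ Finset.range m, ((z ^ (k + r - p : ℤ) : Circle) : ℂ) •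
        (((w ^ (-k : ℤ) : unitary A) : A) * a * (w ^ (p : ℤ) : unitary A)) := by
    intro z
    rw [star_dirichlet, dirichlet, Finset.sum_mul, Finset.sum_mul]
    refine Finset.sum_congr rfl fun k _ => ?_
    rw [Finset.mul_sum]
    refine Finset.sum_congr rfl fun p _ => ?_
    rw [smul_mul_smul_comm, smul_mul_smul_comm]
    congr 1
    rw [sub_eq_add_neg, zpow_add, zpow_add, Circle.coe_mul, Circle.coe_mul]
  simp_rw [h1]
  rw [Finset.sum_comm, Finset.smul_sum]
  refine Finset.sum_congr rfl fun k hk => ?_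
  rw [Finset.sum_comm, Finset.smul_sum]
  refine Finset.sum_congr rfl fun p hp => ?_
  rw [← Finset.sum_smul, sum_toCircle_zpow]
  rw [Finset.mem_range] at hk hp
  by_cases h : (p : ℤ) = k + r
  · simp [h]
  · rw [if_neg h, if_neg, zero_smul, smul_zero]
    -- No aliasing: `|k + r - p| < m + |r| < N`, so divisibility by `N` forces equality.
    intro hd
    have := Int.eq_zero_of_abs_lt_dvd hd (by rw [abs_lt]; omega)
    omega

/-- For `f = 1` the kernels give `∑ D*D = mN`, exactly the normalising factor, so the Cauchy–Schwarz
bound makes the mean contractive. No commutation between `w` and the values of `f` is needed. -/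
theorem norm_fejer_le (m N : ℕ) [NeZero N] (w : unitary A) (f : Circle → A) {c : ℝ} (hN : m < N)
    (hc : ∀ z, ‖f z‖ ≤ c) : ‖fejer m N w f‖ ≤ c := by
  have hc0 : 0 ≤ c := (norm_nonneg _).trans (hc 1)
  rcases subsingleton_or_nontrivial A with hA | hA
  · simpa [Subsingleton.elim (fejer m N w f) 0] using hc0
  have h1 : ∑ j : ZMod N, star (dirichlet m w (ZMod.toCircle j)) * dirichlet m w (ZMod.toCircle j) =
      ((m * N : ℝ) : ℂ) • (1 : A) := by
    have := sum_star_dirichlet_mul_mul m N w 0 1 (by simpa using hN)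
    simp only [zpow_zero, Circle.coe_one, one_smul, mul_one] at this
    rw [this]
    have h2 : ∀ k ∈ Finset.range m, (∑ p ∈ Finset.range m, if (p : ℤ) = k + 0 then
        ((w ^ (-k : ℤ) : unitary A) : A) * (w ^ (p : ℤ) : unitary A) else 0) = 1 := by
      intro k hk
      rw [Finset.sum_eq_single_of_mem k hk, if_pos (by simp), ← Submonoid.coe_mul, ← zpow_add]
      · simp
      · intro b _ hb
        rw [if_neg]
        simpa using hb
    rw [Finset.sum_congr rfl h2]
    simp [Algebra.smul_def, (Nat.cast_commute m (N : A)).eq]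
  have h2 := norm_sum_star_mul_mul_le (fun j : ZMod N => dirichlet m w (ZMod.toCircle j))
    (fun j => f (ZMod.toCircle j)) hc0 fun j => hc _
  rw [h1, norm_smul, norm_one, Complex.norm_real, Real.norm_of_nonneg (by positivity), mul_one]
    at h2
  rw [fejer, norm_smul, ← Complex.ofReal_inv, Complex.norm_real, Real.norm_of_nonneg (by positivity)]
  refine (mul_le_mul_of_nonneg_left h2 (by positivity)).trans ?_
  rw [mul_left_comm]
  -- An inequality suffices here and also covers `m = 0`, where the inverse is zero.
  exact mul_le_of_le_one_right hc0 (inv_mul_le_one)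

theorem fejer_add (m N : ℕ) [NeZero N] (w : unitary A) (f g : Circle → A) :
    fejer m N w (f + g) = fejer m N w f + fejer m N w g := by
  simp [fejer, mul_add, add_mul, Finset.sum_add_distrib]

/-- The double sum counts the `k < m` whose shift by `r` stays in `[0, m)`; at most `|r|` of them
leave. -/
theorem norm_sum_ite_sub_le (m : ℕ) (r : ℤ) :
    ‖(∑ k ∈ Finset.range m, ∑ p ∈ Finset.range m, if (p : ℤ) = k + r then (1 : ℂ) else 0) - m‖ ≤
      r.natAbs := by
  have h1 : (∑ k ∈ Finset.range m, ∑ p ∈ Finset.range m, if (p : ℤ) = k + r then (1 : ℂ) else 0) - m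
      = ∑ k ∈ Finset.range m, if 0 ≤ k + r ∧ k + r < m then (0 : ℂ) else -1 := by
    have : (m : ℂ) = ∑ k ∈ Finset.range m, 1 := by simp
    conv_lhs => rw [this]
    rw [← Finset.sum_sub_distrib]
    refine Finset.sum_congr rfl fun k _ => ?_
    split_ifs with h
    · rw [Finset.sum_eq_single_of_mem (k + r).toNat (by rw [Finset.mem_range]; omega)]
      · rw [if_pos (by omega), sub_self]
      · intro p _ hp
        rw [if_neg (by omega)]
    · rw [Finset.sum_eq_zero, zero_sub]
      intro p hp
      rw [Finset.mem_range] at hp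
      rw [if_neg (by omega)]
  rw [h1]
  refine (norm_sum_le _ _).trans ?_
  have h2 : ∀ k : ℕ, ‖if 0 ≤ k + r ∧ k + r < m then (0 : ℂ) else -1‖ =
      if ¬(0 ≤ k + r ∧ k + r < m) then 1 else 0 := by
    intro k
    split_ifs <;> simp_all
  simp_rw [h2]
  rw [← Finset.sum_filter, Finset.sum_const, nsmul_one]
  norm_cast
  rcases le_or_gt 0 r with hr | hr
  · refine (Finset.card_le_card (t := Finset.Ico (m - r.natAbs) m) ?_).trans ?_
    · intro k hk
      simp only [Finset.mem_filter, Finset.mem_range, Finset.mem_Ico] at hk ⊢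
      omega
    · rw [Nat.card_Ico]; omega
  · refine (Finset.card_le_card (t := Finset.range r.natAbs) ?_).trans (by simp)
    intro k hk
    simp only [Finset.mem_filter, Finset.mem_range] at hk ⊢
    omega

/-- The Fejér mean of `z^r a` at `w` averages `w^(-k) a w^(k+r)` over `k`. Moving `a` to the left
gives `a w^r`, up to commutators and the proportion of lost indices. The orders `m` and `N` are
fixed before `i`, so only finitely many commutators occur. -/
theorem HasSymbol.eventually_fejer (hu : ∀ b : A, Tendsto (fun i => (u i : A) * b - b * u i) l (𝓝 0))
    {f : Circle → A} {X : ι → A} (hf : HasSymbol l u f X) {ε : ℝ} (hε : 0 < ε) :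
    ∀ᶠ m : ℕ in atTop, ∀ᶠ N : ℕ in atTop, ∀ᶠ i in l, ‖fejer m (N + 1) (u i) f - X i‖ ≤ ε := by
  induction hf generalizing ε with
  | add _ _ ih1 ih2 =>
    filter_upwards [ih1 (half_pos hε), ih2 (half_pos hε)] with m h1 h2
    filter_upwards [h1, h2] with N h1 h2
    filter_upwards [h1, h2] with i h1 h2
    rw [fejer_add, Pi.add_apply, add_sub_add_comm]
    linarith [norm_add_le_of_le h1 h2]
  | congr _ hXY ih =>
    filter_upwards [ih (half_pos hε)] with m h1
    filter_upwards [h1] with N h1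
    filter_upwards [h1, hXY.norm.eventually_le_const (by simpa using half_pos hε : ‖(0 : A)‖ < ε / 2)] with i h1 h2
    have := norm_sub_le_of_le h1 h2
    rw [Pi.sub_apply, sub_sub_sub_cancel_right] at this
    linarith
  | monomial r a =>
    have ht : Tendsto (fun m : ℕ => (r.natAbs * ‖a‖) / (m : ℝ)) atTop (𝓝 0) :=
      tendsto_const_nhds.div_atTop tendsto_natCast_atTop_atTop
    filter_upwards [ht.eventually_le_const (half_pos hε), eventually_gt_atTop 0] with m hm hm0
    -- Using `N + 1` sample points keeps their number nonzero and makes the aliasing condition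
    -- strict.
    filter_upwards [eventually_ge_atTop (m + r.natAbs)] with N hN
    set C : ℂ := ∑ k ∈ Finset.range m, ∑ p ∈ Finset.range m, if (p : ℤ) = k + r then (1 : ℂ) else 0
      with hC
    have hm1 : (m : ℂ) ≠ 0 := by exact_mod_cast hm0.ne'
    -- The error splits into a commutator term, which vanishes along `l`, and a counting term of
    -- norm at most `|r| ‖a‖ / m`, uniformly in `w`.
    have hfej : ∀ w : unitary A, fejer m (N + 1) w (fun z => ((z ^ r : Circle) : ℂ) • a) -
        a * (w ^ r : unitary A) = (m : ℂ)⁻¹ • (∑ k ∈ Finset.range m, ∑ p ∈ Finset.range m,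
          if (p : ℤ) = k + r then (((w ^ (-k : ℤ) : unitary A) : A) * a -
            a * (w ^ (-k : ℤ) : unitary A)) * (w ^ (p : ℤ) : unitary A) else 0) +
          ((m : ℂ)⁻¹ * (C - m)) • (a * (w ^ r : unitary A)) := by
      intro w
      rw [fejer, sum_star_dirichlet_mul_mul _ _ _ _ _ (by omega), smul_smul]
      have e1 : ((m * (N + 1 : ℕ) : ℝ)⁻¹ : ℂ) * ((N + 1 : ℕ) : ℂ) = (m : ℂ)⁻¹ := by
        have : ((N + 1 : ℕ) : ℂ) ≠ 0 := by exact_mod_cast (Nat.succ_ne_zero N)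
        push_cast at this ⊢
        field_simp
      have e2 : C • (a * (w ^ r : unitary A)) = ∑ k ∈ Finset.range m, ∑ p ∈ Finset.range m,
          if (p : ℤ) = k + r then (a * (w ^ (-k : ℤ) : unitary A)) * (w ^ (p : ℤ) : unitary A)
          else 0 := by
        rw [hC, Finset.sum_smul]
        refine Finset.sum_congr rfl fun k _ => ?_
        rw [Finset.sum_smul]
        refine Finset.sum_congr rfl fun p _ => ?_
        split_ifs with h
        · rw [one_smul, mul_assoc, ← Submonoid.coe_mul, ← zpow_add, h, neg_add_cancel_left]
        · rw [zero_smul]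
      have e3 : a * ((w ^ r : unitary A) : A) = (m : ℂ)⁻¹ • ((m : ℂ) • (a * (w ^ r : unitary A))) := by
        rw [inv_smul_smul₀ hm1]
      rw [e1, mul_smul, sub_smul, e2, ← smul_add]
      conv_lhs => rw [e3, ← smul_sub]
      congr 1
      rw [← add_sub_assoc, ← Finset.sum_add_distrib]
      congr 1
      refine Finset.sum_congr rfl fun k _ => ?_
      rw [← Finset.sum_add_distrib]
      refine Finset.sum_congr rfl fun p _ => ?_
      split_ifs
      · rw [sub_mul, sub_add_cancel]
      · rw [add_zero]
    have hlim : Tendsto (fun i => (m : ℂ)⁻¹ • (∑ k ∈ Finset.range m, ∑ p ∈ Finset.range m,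
          if (p : ℤ) = k + r then (((u i ^ (-k : ℤ) : unitary A) : A) * a -
            a * (u i ^ (-k : ℤ) : unitary A)) * (u i ^ (p : ℤ) : unitary A) else 0)) l (𝓝 0) := by
      have hkp : ∀ k p : ℕ, Tendsto (fun i => if (p : ℤ) = k + r then
          (((u i ^ (-k : ℤ) : unitary A) : A) * a - a * (u i ^ (-k : ℤ) : unitary A)) *
            (u i ^ (p : ℤ) : unitary A) else 0) l (𝓝 0) := by
        intro k p
        split_ifs with h
        · refine tendsto_zero_mul_unitary (X := fun i => ((u i ^ (-k : ℤ) : unitary A) : A) * a -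
            a * (u i ^ (-k : ℤ) : unitary A)) ?_ fun i => u i ^ (p : ℤ)
          exact zpow_mem (K := asymptoticCommutant l a) (hu a) (-k : ℤ)
        · exact tendsto_const_nhds
      have := (tendsto_finsetSum (Finset.range m) fun k _ =>
        tendsto_finsetSum (Finset.range m) fun p _ => hkp k p).const_smul (m : ℂ)⁻¹
      simpa only [Finset.sum_const_zero, smul_zero] using this
    filter_upwards [hlim.norm.eventually_le_const (by simpa using half_pos hε : ‖(0 : A)‖ < ε / 2)] with i hi
    rw [hfej]
    refine (norm_add_le_of_le hi (r₂ := ε / 2) ?_).trans_eq (add_halves ε)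
    rw [norm_smul, CStarRing.norm_mul_coe_unitary, norm_mul, norm_inv, Complex.norm_natCast]
    refine le_trans ?_ hm
    rw [div_eq_inv_mul, ← mul_assoc]
    gcongr
    exact norm_sum_ite_sub_le m r

theorem HasSymbol.eventually_norm_le
    (hu : ∀ b : A, Tendsto (fun i => (u i : A) * b - b * u i) l (𝓝 0))
    {f : Circle → A} {X : ι → A} (hf : HasSymbol l u f X) {c ε : ℝ} (hc : ∀ z, ‖f z‖ ≤ c)
    (hε : 0 < ε) : ∀ᶠ i in l, ‖X i‖ ≤ c + ε := by
  obtain ⟨m, hm⟩ := (hf.eventually_fejer hu hε).exists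
  obtain ⟨N, hN, hmN⟩ := (hm.and (eventually_ge_atTop m)).exists
  filter_upwards [hN] with i hi
  have h1 := norm_fejer_le m (N + 1) (u i) f (by omega) hc
  have h2 := norm_sub_le_of_le h1 hi
  rwa [sub_sub_cancel] at h2

end Fejer

/-! ### Approximation of continuous functions by symbols -/

/-- A continuous function on a compact metric space with values in a Banach space is uniformly
approximated by finite sums of products of scalar functions and vectors. -/
theorem exists_norm_sub_sum_smul_le {K E : Type*} [MetricSpace K] [CompactSpace K]
    [NormedAddCommGroup E] [NormedSpace ℂ E] (f : C(K, E)) {ε : ℝ} (hε : 0 < ε) :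
    ∃ (s : Finset K) (φ : K → C(K, ℂ)), ∀ z, ‖f z - ∑ j ∈ s, φ j z • f j‖ ≤ ε := by
  let U : K → Set K := fun x => {y | ‖f y - f x‖ < ε}
  have hU : ∀ x, IsOpen (U x) := fun x =>
    isOpen_lt (by fun_prop) continuous_const
  have hxU : ∀ x, x ∈ U x := fun x => by simpa [U] using hε
  obtain ⟨ρ, hρ⟩ := PartitionOfUnity.exists_isSubordinate isClosed_univ U hU
    fun x _ => Set.mem_iUnion.2 ⟨x, hxU x⟩
  have hfin : {j | (Function.support (ρ j)).Nonempty}.Finite :=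
    ρ.locallyFinite.finite_nonempty_of_compact
  refine ⟨hfin.toFinset, fun j => ⟨fun z => (ρ j z : ℂ), by fun_prop⟩, fun z => ?_⟩
  have hsub : ρ.finsupport z ⊆ hfin.toFinset := by
    intro j hj
    rw [PartitionOfUnity.mem_finsupport] at hj
    exact hfin.mem_toFinset.2 ⟨z, hj⟩
  have h1 : ∑ j ∈ hfin.toFinset, ρ j z = 1 := ρ.sum_finsupport' (Set.mem_univ z) hsub
  have h2 : f z = ∑ j ∈ hfin.toFinset, (ρ j z : ℂ) • f z := by
    rw [← Finset.sum_smul, ← Complex.ofReal_sum, h1, Complex.ofReal_one, one_smul]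
  conv_lhs => rw [h2]
  simp only [ContinuousMap.coe_mk]
  rw [← Finset.sum_sub_distrib, ← mul_one ε, ← h1, Finset.mul_sum]
  refine norm_sum_le_of_le _ fun j _ => ?_
  rw [← smul_sub, norm_smul, Complex.norm_real, Real.norm_of_nonneg (ρ.nonneg j z), mul_comm]
  rcases eq_or_ne (ρ j z) 0 with h | h
  · simp [h]
  · exact mul_le_mul_of_nonneg_right (hρ j (subset_closure h)).le (ρ.nonneg j z)

theorem exists_hasSymbol_smul {A ι : Type*} [CStarAlgebra A] (l : Filter ι) (u : ι → unitary A)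
    (φ : C(Circle, ℂ)) (a : A) {ε : ℝ} (hε : 0 < ε) :
    ∃ (g : Circle → A) (X : ι → A), HasSymbol l u g X ∧ ∀ z, ‖φ z • a - g z‖ ≤ ε := by
  let e : UnitAddCircle ≃ₜ Circle := AddCircle.homeomorphCircle one_ne_zero
  let ψ : C(UnitAddCircle, ℂ) := φ.comp e
  have hψ : ψ ∈ closure (Submodule.span ℂ (Set.range (@fourier 1)) :
      Set C(UnitAddCircle, ℂ)) := by
    rw [← Submodule.topologicalClosure_coe, span_fourier_closure_eq_top]
    trivial
  have hspan : ∀ p ∈ Submodule.span ℂ (Set.range (@fourier 1)),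
      ∃ X : ι → A, HasSymbol l u (fun z => p (e.symm z) • a) X := by
    intro p hp
    -- `HasSymbol` has no constructor for scalar multiples, so the induction carries a free scalar
    -- in the coefficient.
    suffices h : ∀ c : ℂ, ∃ X : ι → A, HasSymbol l u (fun z => p (e.symm z) • c • a) X by
      simpa using h 1
    induction hp using Submodule.span_induction with
    | mem p hp =>
      obtain ⟨k, rfl⟩ := hp
      intro c
      refine ⟨fun i => c • a * (u i ^ k : unitary A), ?_⟩
      convert HasSymbol.monomial k (c • a) using 3 with z
      rw [fourier_apply, AddCircle.toCircle_zsmul,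
        ← AddCircle.homeomorphCircle_apply one_ne_zero, Homeomorph.apply_symm_apply]
    | zero => exact fun c => ⟨fun _ => 0, by simpa using HasSymbol.const 0⟩
    | add p q _ _ hp hq =>
      intro c
      obtain ⟨X, hX⟩ := hp c
      obtain ⟨Y, hY⟩ := hq c
      refine ⟨X + Y, ?_⟩
      convert hX.add hY using 1
      ext z
      simp [add_smul]
    | smul d p _ hp =>
      intro c
      obtain ⟨X, hX⟩ := hp (d * c)
      refine ⟨X, ?_⟩
      convert hX using 2 with z
      simp [smul_smul]
      ring_nf
  -- The summand `1` keeps the denominator positive when `a = 0`.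
  obtain ⟨p, hp, hpψ⟩ := Metric.mem_closure_iff.1 hψ (ε / (‖a‖ + 1)) (by positivity)
  obtain ⟨X, hX⟩ := hspan p hp
  refine ⟨_, X, hX, fun z => ?_⟩
  rw [← sub_smul, norm_smul]
  have h1 : ‖φ z - p (e.symm z)‖ ≤ ε / (‖a‖ + 1) := by
    refine le_trans ?_ hpψ.le
    rw [dist_eq_norm]
    simpa [ψ] using (ψ - p).norm_coe_le_norm (e.symm z)
  calc _ ≤ ε / (‖a‖ + 1) * (‖a‖ + 1) := by gcongr; linarith
    _ = ε := by field_simp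

theorem exists_hasSymbol {A ι : Type*} [CStarAlgebra A] (l : Filter ι) (u : ι → unitary A)
    {f : Circle → A} (hf : Continuous f) {ε : ℝ} (hε : 0 < ε) :
    ∃ (g : Circle → A) (X : ι → A), HasSymbol l u g X ∧ ∀ z, ‖f z - g z‖ ≤ ε := by
  obtain ⟨s, φ, hφ⟩ := exists_norm_sub_sum_smul_le ⟨f, hf⟩ (half_pos hε)
  have hs : 0 < ε / 2 / (s.card + 1) := by positivity
  choose g X hgX hg using fun j => exists_hasSymbol_smul l u (φ j) (f j) hs
  refine ⟨_, _, HasSymbol.sum s fun j _ => hgX j, fun z => ?_⟩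
  have h1 : ‖∑ j ∈ s, φ j z • f j - ∑ j ∈ s, g j z‖ ≤ ε / 2 := by
    rw [← Finset.sum_sub_distrib]
    refine (norm_sum_le_of_le s fun j _ => hg j z).trans ?_
    rw [Finset.sum_const, nsmul_eq_mul, mul_div_left_comm]
    refine mul_le_of_le_one_right (by positivity) ?_
    rw [div_le_one (by positivity)]
    linarith
  have h2 := norm_add_le_of_le (hφ z) h1
  simp only [ContinuousMap.coe_mk, sub_add_sub_cancel] at h2
  rw [Finset.sum_apply]
  linarith

/-! ### Perturbing approximate partitions of unity to exact ones -/

section Stability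

variable {A ι κ : Type*} [CStarAlgebra A] [Fintype κ] {l : Filter ι}

theorem isBoundedUnder_norm_of_tendsto_sub {X Y : ι → A} (hY : IsBoundedUnder (· ≤ ·) l (norm ∘ Y))
    (h : Tendsto (fun i => X i - Y i) l (𝓝 0)) : IsBoundedUnder (· ≤ ·) l (norm ∘ X) := by
  obtain ⟨C, hC⟩ := hY
  refine ⟨1 + C, ?_⟩
  rw [eventually_map] at *
  filter_upwards [hC, h.norm.eventually_le_const (by simp : ‖(0 : A)‖ < 1)] with i h1 h2
  simpa using norm_add_le_of_le h2 h1

theorem isBoundedUnder_norm_sum_smul {E : κ → ι → A}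
    (hE : ∀ g, IsBoundedUnder (· ≤ ·) l (norm ∘ E g)) (c : κ → ℝ) :
    IsBoundedUnder (· ≤ ·) l (norm ∘ fun i => ∑ g, c g • E g i) := by
  choose C hC using hE
  refine ⟨∑ g, |c g| * C g, ?_⟩
  simp only [eventually_map] at *
  filter_upwards [eventually_all.2 hC] with i hi
  refine norm_sum_le_of_le _ fun g _ => ?_
  rw [norm_smul, Real.norm_eq_abs]
  exact mul_le_mul_of_nonneg_left (hi g) (abs_nonneg _)

variable [DecidableEq κ]

/-- For exact orthogonal projections summing to one, a polynomial in `∑ x_g E_g` is evaluated at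
each `x_g`. Induction on the degree propagates the asymptotic relations; the sum relation handles
constants. -/
theorem tendsto_aeval_sub_sum {E : κ → ι → A} {H : ι → A} {x : κ → ℝ}
    (hE : ∀ g, IsBoundedUnder (· ≤ ·) l (norm ∘ E g))
    (hmul : ∀ g h, Tendsto (fun i => E g i * E h i - if g = h then E g i else 0) l (𝓝 0))
    (hsum : Tendsto (fun i => ∑ g, E g i - 1) l (𝓝 0))
    (hH : Tendsto (fun i => H i - ∑ g, x g • E g i) l (𝓝 0)) (Q : Polynomial ℝ) :
    Tendsto (fun i => Polynomial.aeval (H i) Q - ∑ g, Q.eval (x g) • E g i) l (𝓝 0) := by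
  induction Q using Polynomial.induction_on with
  | C a =>
    have := (hsum.const_smul a).neg
    rw [smul_zero, neg_zero] at this
    refine this.congr fun i => ?_
    simp [smul_sub, Algebra.algebraMap_eq_smul_one, Finset.smul_sum]
  | add p q hp hq =>
    have := hp.add hq
    rw [add_zero] at this
    refine this.congr fun i => ?_
    simp [add_smul, Finset.sum_add_distrib, add_sub_add_comm]
  | monomial n a ih =>
    set P : Polynomial ℝ := Polynomial.C a * Polynomial.X ^ n with hP
    have hb := isBoundedUnder_norm_sum_smul hE
    have h1 := ih.zero_mul_isBoundedUnder_le (isBoundedUnder_norm_of_tendsto_sub (hb x) hH)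
    have h2 := isBoundedUnder_le_mul_tendsto_zero (hb fun g => P.eval (x g)) hH
    have h3 : Tendsto (fun i => ∑ g, ∑ h, (P.eval (x g) * x h) •
        (E g i * E h i - if g = h then E g i else 0)) l (𝓝 0) := by
      have := tendsto_finsetSum Finset.univ fun g _ => tendsto_finsetSum Finset.univ fun h _ =>
        (hmul g h).const_smul (P.eval (x g) * x h)
      simpa only [Finset.sum_const_zero, smul_zero] using this
    have := (h1.add h2).add h3
    rw [add_zero, add_zero] at this
    refine this.congr fun i => ?_
    have e1 : Polynomial.C a * Polynomial.X ^ (n + 1) = P * Polynomial.X := by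
      rw [hP, pow_succ, mul_assoc]
    have e2 : ∑ g, ∑ h, (P.eval (x g) * x h) • (E g i * E h i - if g = h then E g i else 0) =
        (∑ g, P.eval (x g) • E g i) * (∑ g, x g • E g i) -
          ∑ g, (P.eval (x g) * x g) • E g i := by
      rw [Finset.sum_mul_sum, ← Finset.sum_sub_distrib]
      refine Finset.sum_congr rfl fun g _ => ?_
      simp [smul_sub, Finset.sum_sub_distrib, smul_smul, mul_comm]
    rw [e1, e2]
    simp only [map_mul, Polynomial.aeval_X, Polynomial.eval_mul, Polynomial.eval_X]
    noncomm_ring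

/-- The spectrum lies in separated intervals around the `x_g`, so the indicator of each interval is
continuous on it and yields a spectral projection. -/
theorem exists_isStarProjection_of_spectrum {H : A} (hH : IsSelfAdjoint H) {x : κ → ℝ}
    (hx : ∀ g h, g ≠ h → 1 ≤ |x g - x h|) {η ε : ℝ} (hη : η ≤ 1 / 4) (hε : 0 ≤ ε)
    (hspec : ∀ t ∈ spectrum ℝ H, ∃ g, |t - x g| < η) (Q : κ → Polynomial ℝ)
    (hQ : ∀ g h t, |t - x h| < η → |(if g = h then 1 else 0) - (Q g).eval t| ≤ ε) :
    ∃ e : κ → A, (∀ g, IsStarProjection (e g)) ∧ (∀ g h, g ≠ h → e g * e h = 0) ∧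
      ∑ g, e g = 1 ∧ ∀ g, ‖e g - Polynomial.aeval H (Q g)‖ ≤ ε := by
  -- A trapezoid equal to `1` within `1/4` of `x_g` and to `0` beyond `1/2`. With gaps at least `1`
  -- and `η ≤ 1/4`, every other interval is more than `3/4` away.
  let χ : κ → ℝ → ℝ := fun g t => max 0 (min 1 (2 - 4 * |t - x g|))
  have hχc : ∀ g, Continuous (χ g) := fun g => by fun_prop
  have hχ : ∀ g h t, |t - x h| < η → χ g t = if g = h then 1 else 0 := by
    intro g h t ht
    split_ifs with hgh
    · subst hgh
      simp only [χ]
      rw [min_eq_left (by linarith), max_eq_right zero_le_one]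
    · have h1 := hx g h hgh
      have h2 : |x g - x h| ≤ |t - x g| + |t - x h| := by
        rw [abs_sub_comm t (x g)]
        exact abs_sub_le _ _ _
      exact max_eq_left ((min_le_right _ _).trans (by linarith))
  refine ⟨fun g => cfc (χ g) H, fun g => ⟨?_, cfc_predicate _ _⟩, fun g h hgh => ?_, ?_,
    fun g => ?_⟩
  · change cfc (χ g) H * cfc (χ g) H = _
    rw [← cfc_mul (χ g) (χ g) H (hχc g).continuousOn (hχc g).continuousOn]
    refine cfc_congr fun t ht => ?_
    obtain ⟨h, hh⟩ := hspec t ht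
    simp [hχ g h t hh]
  · change cfc (χ g) H * cfc (χ h) H = _
    rw [← cfc_mul (χ g) (χ h) H (hχc g).continuousOn (hχc h).continuousOn, ← cfc_const_zero ℝ H]
    refine cfc_congr fun t ht => ?_
    obtain ⟨k, hk⟩ := hspec t ht
    have : ¬(g = k ∧ h = k) := fun hc => hgh (hc.1.trans hc.2.symm)
    simp only [hχ g k t hk, hχ h k t hk]
    split_ifs <;> simp_all
  · rw [← cfc_sum_univ χ H fun g => (hχc g).continuousOn, ← cfc_const_one ℝ H]
    refine cfc_congr fun t ht => ?_
    obtain ⟨k, hk⟩ := hspec t ht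
    simp [hχ _ k t hk]
  · rw [← cfc_polynomial (Q g) H, ← cfc_sub (χ g) _ H (hχc g).continuousOn]
    refine norm_cfc_le hε fun t ht => ?_
    obtain ⟨k, hk⟩ := hspec t ht
    rw [hχ g k t hk, Real.norm_eq_abs]
    exact hQ g k t hk

/-- The whole family is encoded in one self-adjoint `H ≈ ∑ x_g E_g` with distinct integers `x_g`.
The polynomial `L` vanishing at these points makes `L(H)` small, which confines the spectrum, and
Lagrange polynomials recover `E_g ≈ Q_g(H)`. -/
theorem eventually_exists_isStarProjection {E : κ → ι → A}
    (hE : ∀ g, IsBoundedUnder (· ≤ ·) l (norm ∘ E g))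
    (hmul : ∀ g h, Tendsto (fun i => E g i * E h i - if g = h then E g i else 0) l (𝓝 0))
    (hstar : ∀ g, Tendsto (fun i => star (E g i) - E g i) l (𝓝 0))
    (hsum : Tendsto (fun i => ∑ g, E g i - 1) l (𝓝 0)) {ε : ℝ} (hε : 0 < ε) :
    ∀ᶠ i in l, ∃ e : κ → A, (∀ g, IsStarProjection (e g)) ∧ (∀ g h, g ≠ h → e g * e h = 0) ∧
      ∑ g, e g = 1 ∧ ∀ g, ‖e g - E g i‖ ≤ ε := by
  let x : κ → ℝ := fun g => (Fintype.equivFin κ g : ℕ)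
  have hx : ∀ g h, g ≠ h → 1 ≤ |x g - x h| := by
    intro g h hgh
    have h1 : ((Fintype.equivFin κ g : ℕ) : ℤ) ≠ (Fintype.equivFin κ h : ℕ) := by
      simpa [Fin.val_inj] using hgh
    have h2 := Int.one_le_abs (sub_ne_zero.2 h1)
    rw [← Int.cast_le (R := ℝ)] at h2
    simpa [x] using h2
  have hxinj : Set.InjOn x (Finset.univ : Finset κ) := by
    intro g _ h _ hgh
    by_contra hne
    have := hx g h hne
    rw [hgh, sub_self, abs_zero] at this
    linarith
  let H : ι → A := fun i => ∑ g, x g • (2⁻¹ : ℝ) • (E g i + star (E g i))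
  have hHsa : ∀ i, IsSelfAdjoint (H i) := by
    intro i
    simp [H, isSelfAdjoint_iff, star_sum, add_comm]
  have hH : Tendsto (fun i => H i - ∑ g, x g • E g i) l (𝓝 0) := by
    have := tendsto_finsetSum Finset.univ fun g _ => ((hstar g).const_smul (2⁻¹ : ℝ)).const_smul (x g)
    simp only [Finset.sum_const_zero, smul_zero] at this
    refine this.congr fun i => ?_
    simp only [H]
    rw [← Finset.sum_sub_distrib]
    refine Finset.sum_congr rfl fun g _ => ?_
    module
  let L : Polynomial ℝ := ∏ g, (Polynomial.X - Polynomial.C (x g))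
  let Q : κ → Polynomial ℝ := fun g => Lagrange.basis Finset.univ x g
  have hQeval : ∀ g h, (Q g).eval (x h) = if g = h then 1 else 0 := by
    intro g h
    split_ifs with hgh
    · subst hgh
      exact Lagrange.eval_basis_self hxinj (Finset.mem_univ _)
    · exact Lagrange.eval_basis_of_ne hgh (Finset.mem_univ _)
  have hη : ∀ᶠ η in 𝓝[>] (0 : ℝ), ∀ g h t, |t - x h| < η →
      |(if g = h then 1 else 0) - (Q g).eval t| ≤ ε / 2 := by
    refine eventually_all.2 fun g => eventually_all.2 fun h => ?_
    obtain ⟨δ, hδ, hδt⟩ := Metric.continuousAt_iff.1 ((Q g).continuous.continuousAt (x := x h))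
      (ε / 2) (half_pos hε)
    filter_upwards [Ioo_mem_nhdsGT hδ] with η hη t ht
    have := hδt (x := t) (by rw [Real.dist_eq]; exact ht.trans hη.2)
    rw [dist_comm, Real.dist_eq, hQeval] at this
    exact this.le
  obtain ⟨η, hηQ, hη0, hη4⟩ := (hη.and (Ioc_mem_nhdsGT (by norm_num : (0 : ℝ) < 1 / 4))).exists
  have hL := tendsto_aeval_sub_sum hE hmul hsum hH L
  have hL0 : ∀ g, L.eval (x g) = 0 := by
    intro g
    rw [Polynomial.eval_prod]
    exact Finset.prod_eq_zero (Finset.mem_univ g) (by simp)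
  simp only [hL0, zero_smul, Finset.sum_const_zero, sub_zero] at hL
  have hQ := fun g => tendsto_aeval_sub_sum hE hmul hsum hH (Q g)
  simp only [hQeval, ite_smul, one_smul, zero_smul, Finset.sum_ite_eq, Finset.mem_univ, if_true]
    at hQ
  filter_upwards [hL.norm.eventually_lt_const
      (by simpa using pow_pos hη0 _ : ‖(0 : A)‖ < η ^ Fintype.card κ),
    eventually_all.2 fun g => (hQ g).norm.eventually_le_const
      (by simpa using half_pos hε : ‖(0 : A)‖ < ε / 2)] with i hi1 hi2
  have hspec : ∀ t ∈ spectrum ℝ (H i), ∃ g, |t - x g| < η := by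
    intro t ht
    by_contra! hcon
    have h1 : ‖L.eval t‖ ≤ ‖Polynomial.aeval (H i) L‖ := by
      rw [← cfc_polynomial L (H i) (hHsa i)]
      exact norm_apply_le_norm_cfc (fun s => L.eval s) (H i) ht L.continuous.continuousOn (hHsa i)
    -- A spectral point at distance at least `η` from all nodes makes every factor of `L(t)` at
    -- least `η`, contradicting the smallness of `L(H)`.
    have h2 : η ^ Fintype.card κ ≤ ‖L.eval t‖ := by
      rw [Polynomial.eval_prod, Real.norm_eq_abs, Finset.abs_prod, Fintype.card, ← Finset.prod_const]
      refine Finset.prod_le_prod (fun _ _ => hη0.le) fun g _ => ?_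
      simpa using hcon g
    linarith
  obtain ⟨e, he1, he2, he3, he4⟩ := exists_isStarProjection_of_spectrum (hHsa i) hx hη4
    (half_pos hε).le hspec Q hηQ
  refine ⟨e, he1, he2, he3, fun g => ?_⟩
  have := norm_add_le_of_le (he4 g) (hi2 g)
  rwa [sub_add_sub_cancel, add_halves] at this

end Stability

/-! ### Matrix unit relations in the word space -/

section SiteUnit

variable {n : ℕ}

theorem siteUnit_apply (k : ℕ) (i j : Fin n) (ξ : WordSpace n) (w : ℕ → Fin n) :
    siteUnit n k i j ξ w = if w k = i then ξ (Function.update w k j) else 0 := rfl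

theorem norm_siteUnit_le (k : ℕ) (i j : Fin n) : ‖siteUnit n k i j‖ ≤ 1 :=
  LinearMap.mkContinuous_norm_le _ zero_le_one _

theorem siteUnit_mul_siteUnit (k : ℕ) (i j p q : Fin n) :
    siteUnit n k i j * siteUnit n k p q = if j = p then siteUnit n k i q else 0 := by
  ext ξ w
  by_cases hj : j = p <;> by_cases hw : w k = i <;> simp [siteUnit_apply, hj, hw]

theorem sum_siteUnit (k : ℕ) : ∑ i, siteUnit n k i i = 1 := by
  ext ξ w
  have : ∀ i, siteUnit n k i i ξ w = if w k = i then ξ w else 0 := by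
    intro i
    rw [siteUnit_apply]
    split_ifs with h
    · rw [← h, Function.update_eq_self]
    · rfl
  rw [sum_apply, lp.coeFn_sum]
  exact (Finset.sum_apply _ _ _).trans (by simp [this])

theorem commute_siteUnit {k m : ℕ} (hkm : k ≠ m) (i j p q : Fin n) :
    Commute (siteUnit n k i j) (siteUnit n m p q) := by
  ext ξ w
  by_cases h1 : w k = i <;> by_cases h2 : w m = p <;>
    simp [siteUnit_apply, h1, h2, hkm, hkm.symm, Function.update_comm hkm]

theorem star_siteUnit (k : ℕ) (i j : Fin n) : star (siteUnit n k i j) = siteUnit n k j i := by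
  rw [ContinuousLinearMap.star_eq_adjoint, eq_comm, ContinuousLinearMap.eq_adjoint_iff]
  intro ξ η
  rw [lp.inner_eq_tsum, lp.inner_eq_tsum]
  -- Swapping the letters `i` and `j` at site `k` is a bijection of words that matches the two inner
  -- product series term by term.
  let σ : (ℕ → Fin n) ≃ (ℕ → Fin n) :=
    Function.Involutive.toPerm (fun w => Function.update w k (Equiv.swap i j (w k)))
      fun w => by simp
  have hσ : ∀ w, σ w = Function.update w k (Equiv.swap i j (w k)) := fun _ => rfl
  rw [← σ.tsum_eq]
  refine tsum_congr fun w => ?_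
  rw [hσ, siteUnit_apply, siteUnit_apply, Function.update_self, Function.update_idem]
  by_cases h : w k = i
  · have h1 : Function.update w k i = w := by rw [← h, Function.update_eq_self]
    rw [if_pos h, if_pos (by simp [h]), h1, h, Equiv.swap_apply_left]
  · have h1 : Equiv.swap i j (w k) ≠ j := by
      rw [Ne, Equiv.swap_apply_eq_iff]
      simpa using h
    rw [if_neg h, if_neg h1, inner_zero_left, inner_zero_right]

end SiteUnit

/-! ### Asymptotic centralizers -/

section Central

variable {A ι : Type*} [CStarAlgebra A] {l : Filter ι}

/-- The elements that asymptotically commute with `T` and with its adjoints. -/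
def asymptoticCentralizer (l : Filter ι) (T : ι → A) : StarSubalgebra ℂ A where
  carrier := {a | Tendsto (fun i => T i * a - a * T i) l (𝓝 0) ∧
    Tendsto (fun i => star (T i) * a - a * star (T i)) l (𝓝 0)}
  mul_mem' := by
    rintro a b ⟨ha1, ha2⟩ ⟨hb1, hb2⟩
    have h1 := (ha1.mul_const b).add (hb1.const_mul a)
    have h2 := (ha2.mul_const b).add (hb2.const_mul a)
    simp only [zero_mul, mul_zero, add_zero] at h1 h2
    exact ⟨h1.congr fun i => by noncomm_ring, h2.congr fun i => by noncomm_ring⟩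
  add_mem' := by
    rintro a b ⟨ha1, ha2⟩ ⟨hb1, hb2⟩
    have h1 := ha1.add hb1
    have h2 := ha2.add hb2
    simp only [add_zero] at h1 h2
    exact ⟨h1.congr fun i => by noncomm_ring, h2.congr fun i => by noncomm_ring⟩
  algebraMap_mem' := by
    intro c
    have h : ∀ x : A, x * algebraMap ℂ A c - algebraMap ℂ A c * x = 0 := fun x => by
      rw [Algebra.commutes, sub_self]
    exact ⟨tendsto_const_nhds.congr fun i => (h _).symm,
      tendsto_const_nhds.congr fun i => (h _).symm⟩
  star_mem' := by
    rintro a ⟨ha1, ha2⟩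
    have h1 := ha1.star.neg
    have h2 := ha2.star.neg
    simp only [star_zero, neg_zero] at h1 h2
    exact ⟨h2.congr fun i => by simp, h1.congr fun i => by simp⟩

theorem tendsto_commutator_of_mem_closure {T : ι → A} (hT : ∀ i, ‖T i‖ ≤ 1) {s : Set A}
    (hs : ∀ a ∈ s, Tendsto (fun i => T i * a - a * T i) l (𝓝 0)) {a : A} (ha : a ∈ closure s) :
    Tendsto (fun i => T i * a - a * T i) l (𝓝 0) := by
  rw [Metric.tendsto_nhds]
  intro ε hε
  obtain ⟨b, hb, hab⟩ := Metric.mem_closure_iff.1 ha (ε / 4) (by positivity)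
  rw [dist_eq_norm] at hab
  filter_upwards [Metric.tendsto_nhds.1 (hs b hb) (ε / 4) (by positivity)] with i hi
  rw [dist_zero_right] at hi ⊢
  have h1 : T i * a - a * T i = T i * (a - b) - (a - b) * T i + (T i * b - b * T i) := by
    noncomm_ring
  have h2 : ‖T i * (a - b)‖ ≤ 1 * (ε / 4) := norm_mul_le_of_le (hT i) hab.le
  have h3 : ‖(a - b) * T i‖ ≤ ε / 4 * 1 := norm_mul_le_of_le hab.le (hT i)
  rw [h1]
  linarith [norm_add_le (T i * (a - b) - (a - b) * T i) (T i * b - b * T i),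
    norm_sub_le (T i * (a - b)) ((a - b) * T i)]

theorem isClosed_asymptoticCentralizer {T : ι → A} (hT : ∀ i, ‖T i‖ ≤ 1) :
    IsClosed (asymptoticCentralizer l T : Set A) :=
  isClosed_of_closure_subset fun _ ha =>
    ⟨tendsto_commutator_of_mem_closure hT (fun _ hb => hb.1) ha,
      tendsto_commutator_of_mem_closure (fun i => (norm_star (T i)).trans_le (hT i))
        (fun _ hb => hb.2) ha⟩

theorem mem_asymptoticCentralizer_of_commute {T : ι → A} {a : A} (h : ∀ i, Commute (T i) a)
    (h' : ∀ i, Commute (star (T i)) a) : a ∈ asymptoticCentralizer l T := by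
  refine ⟨?_, ?_⟩
  · simpa only [(h _).eq, sub_self] using tendsto_const_nhds
  · simpa only [(h' _).eq, sub_self] using tendsto_const_nhds

end Central

/-! ### Asymptotically central matrix units from absorption -/

section MatrixUnits

theorem uhfSubalgebra_le_asymptoticCentralizer (n : ℕ) (i j : Fin n) :
    uhfSubalgebra n ≤ asymptoticCentralizer atTop fun k => siteUnit n k i j := by
  refine StarSubalgebra.topologicalClosure_minimal
    (StarAlgebra.adjoin_le ?_) (isClosed_asymptoticCentralizer fun k => norm_siteUnit_le k i j)
  rintro _ ⟨k, p, q, rfl⟩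
  constructor
  · refine tendsto_const_nhds.congr' ?_
    filter_upwards [eventually_gt_atTop k] with m hm
    rw [(commute_siteUnit hm.ne' i j p q).eq, sub_self]
  · refine tendsto_const_nhds.congr' ?_
    filter_upwards [eventually_gt_atTop k] with m hm
    rw [star_siteUnit, (commute_siteUnit hm.ne' j i p q).eq, sub_self]

/-- The matrix unit `siteUnit n k i j` as an element of the UHF algebra. -/
def uhfUnit (n k : ℕ) (i j : Fin n) : UHF n :=
  ⟨siteUnit n k i j, StarSubalgebra.le_topologicalClosure _
    (StarAlgebra.subset_adjoin ℂ _ ⟨k, i, j, rfl⟩)⟩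

theorem star_uhfUnit (n k : ℕ) (i j : Fin n) : star (uhfUnit n k i j) = uhfUnit n k j i :=
  Subtype.ext (star_siteUnit k i j)

theorem tendsto_uhfUnit_commutator (n : ℕ) (i j : Fin n) (b : UHF n) :
    Tendsto (fun k => uhfUnit n k i j * b - b * uhfUnit n k i j) atTop (𝓝 0) := by
  rw [tendsto_zero_iff_norm_tendsto_zero]
  have h := tendsto_zero_iff_norm_tendsto_zero.1
    (uhfSubalgebra_le_asymptoticCentralizer n i j b.2).1
  exact h

/-- The images of the units at site `m` commute exactly with the first tensor factor and, as `m →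
∞`, asymptotically with the second. The asymptotic centralizer is a closed algebra, so density of
the products gives all of `A`. -/
theorem AbsorbsUHF.exists_matrixUnits {A : Type*} [CStarAlgebra A] {n : ℕ} [NeZero n]
    (hA : AbsorbsUHF n A) :
    ∃ e : ℕ → ZMod n → ZMod n → A, (∀ m k l, star (e m k l) = e m l k) ∧
      (∀ m k l p q, e m k l * e m p q = if l = p then e m k q else 0) ∧
      (∀ m, ∑ k, e m k k = 1) ∧ (∀ m k l, ‖e m k l‖ ≤ 1) ∧
      ∀ k l a, Tendsto (fun m => e m k l * a - a * e m k l) atTop (𝓝 0) := by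
  obtain ⟨φ, ψ, h⟩ := hA
  let σ : ZMod n ≃ Fin n := (ZMod.finEquiv n).symm.toEquiv
  have hnorm : ∀ m k l, ‖ψ (uhfUnit n m k l)‖ ≤ 1 := fun m k l =>
    (NonUnitalStarAlgHom.norm_apply_le ψ _).trans (norm_siteUnit_le m k l)
  have hcomm : ∀ k l (b : UHF n), Tendsto (fun m => ψ (uhfUnit n m k l) * ψ b -
      ψ b * ψ (uhfUnit n m k l)) atTop (𝓝 0) := by
    intro k l b
    refine squeeze_zero_norm (fun m => ?_)
      (tendsto_zero_iff_norm_tendsto_zero.1 (tendsto_uhfUnit_commutator n k l b))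
    rw [← map_mul, ← map_mul, ← map_sub]
    exact NonUnitalStarAlgHom.norm_apply_le ψ _
  refine ⟨fun m k l => ψ (uhfUnit n m (σ k) (σ l)), fun m k l => ?_, fun m k l p q => ?_,
    fun m => ?_, fun m k l => hnorm _ _ _, fun k l a => ?_⟩
  · rw [← map_star, star_uhfUnit]
  · rw [← map_mul]
    have : uhfUnit n m (σ k) (σ l) * uhfUnit n m (σ p) (σ q) =
        if l = p then uhfUnit n m (σ k) (σ q) else 0 := by
      refine Subtype.ext ((siteUnit_mul_siteUnit m (σ k) (σ l) (σ p) (σ q)).trans ?_)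
      simp only [σ.injective.eq_iff]
      split_ifs <;> rfl
    rw [this]
    split_ifs
    · rfl
    · exact map_zero ψ
  · rw [← map_sum, σ.sum_comp fun k => uhfUnit n m k k]
    have : ∑ k, uhfUnit n m k k = 1 := by
      refine Subtype.ext ?_
      rw [AddSubmonoidClass.coe_finsetSum]
      exact sum_siteUnit m
    rw [this, map_one]
  · set S := asymptoticCentralizer atTop fun m => ψ (uhfUnit n m (σ k) (σ l))
    suffices a ∈ S from this.1
    have hφ : ∀ a, φ a ∈ S := fun a => mem_asymptoticCentralizer_of_commute
      (fun m => (h.commute a _).symm)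
      fun m => by rw [← map_star]; exact (h.commute a _).symm
    have hψ : ∀ b, ψ b ∈ S := fun b => ⟨hcomm _ _ b, by
      simpa only [← map_star, star_uhfUnit] using hcomm (σ l) (σ k) b⟩
    refine (isClosed_asymptoticCentralizer fun m => hnorm _ _ _).closure_subset_iff.2 ?_
      (h.denseRange a)
    rintro _ ⟨t, rfl⟩
    induction t using TensorProduct.induction_on with
    | zero => rw [map_zero]; exact zero_mem S
    | add x y hx hy => rw [map_add]; exact add_mem hx hy
    | tmul x y => exact mul_mem (hφ x) (hψ y)

end MatrixUnits

/-! ### Rank one projections attached to points of the circle -/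

section RankOne

variable {A : Type*} [CStarAlgebra A] {n : ℕ} [NeZero n] {e : ZMod n → ZMod n → A}

theorem sum_toCircle_pow_val (d : ZMod n) :
    ∑ k : ZMod n, ((ZMod.toCircle d ^ (k.val : ℤ) : Circle) : ℂ) = if d = 0 then (n : ℂ) else 0 := by
  have h := AddChar.sum_mulShift d (ZMod.isPrimitive_stdAddChar n)
  rw [ZMod.card, Nat.cast_ite, Nat.cast_zero] at h
  rw [← h]
  refine Finset.sum_congr rfl fun k _ => ?_
  rw [ZMod.stdAddChar_apply, zpow_natCast, ← AddChar.map_nsmul_eq_pow, nsmul_eq_mul,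
    ZMod.natCast_zmod_val]

/-- The rank one projection onto the line spanned by `(1, c, c ^ 2, …)`, with respect to the matrix
units `e`. -/
def rankOne (e : ZMod n → ZMod n → A) (c : Circle) : A :=
  (n : ℂ)⁻¹ • ∑ k, ∑ l, ((c ^ (k.val - l.val : ℤ) : Circle) : ℂ) • e k l

theorem star_rankOne (hstar : ∀ k l, star (e k l) = e l k) (c : Circle) :
    star (rankOne e c) = rankOne e c := by
  simp only [rankOne, star_smul, star_sum, hstar, star_inv₀, star_natCast]
  rw [Finset.sum_comm]
  congr 1
  refine Finset.sum_congr rfl fun k _ => Finset.sum_congr rfl fun l _ => ?_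
  rw [← neg_sub, zpow_neg, Circle.coe_inv_eq_conj]
  simp

/-- The spanning vectors have inner product `∑ ω^l`, with `ω` the root of unity of `t`; this is `n`
for `t = 0` and vanishes otherwise. -/
theorem rankOne_mul_rankOne_toCircle_mul
    (hmul : ∀ k l p q, e k l * e p q = if l = p then e k q else 0) (c : Circle) (t : ZMod n) :
    rankOne e c * rankOne e (ZMod.toCircle t * c) = if t = 0 then rankOne e c else 0 := by
  have hn : (n : ℂ) ≠ 0 := NeZero.ne _
  have hcoef : ∀ k q : ZMod n, ∑ l : ZMod n, ((c ^ (k.val - l.val : ℤ) : Circle) : ℂ) *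
      (((ZMod.toCircle t * c) ^ (l.val - q.val : ℤ) : Circle) : ℂ) =
      if t = 0 then n * ((c ^ (k.val - q.val : ℤ) : Circle) : ℂ) else 0 := by
    intro k q
    have h1 : ∀ l : ZMod n, ((c ^ (k.val - l.val : ℤ) : Circle) : ℂ) *
        (((ZMod.toCircle t * c) ^ (l.val - q.val : ℤ) : Circle) : ℂ) =
        ((ZMod.toCircle t ^ (l.val : ℤ) : Circle) : ℂ) *
        ((ZMod.toCircle t ^ (-q.val : ℤ) * c ^ (k.val - q.val : ℤ) : Circle) : ℂ) := by
      intro l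
      rw [← Circle.coe_mul, ← Circle.coe_mul, mul_zpow, mul_left_comm, ← zpow_add, ← mul_assoc,
        ← zpow_add, ← sub_eq_add_neg, sub_add_sub_cancel]
    simp_rw [h1]
    rw [← Finset.sum_mul, sum_toCircle_pow_val]
    by_cases ht : t = 0 <;> simp [ht]
  have hprod : rankOne e c * rankOne e (ZMod.toCircle t * c) =
      ((n : ℂ)⁻¹ * (n : ℂ)⁻¹) • ∑ k, ∑ q,
      (∑ l : ZMod n, ((c ^ (k.val - l.val : ℤ) : Circle) : ℂ) *
        (((ZMod.toCircle t * c) ^ (l.val - q.val : ℤ) : Circle) : ℂ)) • e k q := by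
    rw [rankOne, rankOne, smul_mul_smul_comm, Finset.sum_mul]
    congr 1
    refine Finset.sum_congr rfl fun k _ => ?_
    simp_rw [Finset.sum_smul]
    conv_rhs => rw [Finset.sum_comm]
    rw [Finset.sum_mul]
    refine Finset.sum_congr rfl fun l _ => ?_
    rw [Finset.mul_sum, Finset.sum_eq_single l]
    · rw [Finset.mul_sum]
      refine Finset.sum_congr rfl fun q _ => ?_
      rw [smul_mul_smul_comm, hmul, if_pos rfl]
    · intro p _ hp
      rw [Finset.mul_sum]
      refine Finset.sum_eq_zero fun q _ => ?_
      rw [smul_mul_smul_comm, hmul, if_neg hp.symm, smul_zero]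
    · simp
  rw [hprod]
  simp_rw [hcoef]
  split_ifs
  · rw [rankOne]
    simp_rw [mul_smul (n : ℂ) _ (_ : A), ← Finset.smul_sum]
    rw [smul_smul, inv_mul_cancel_right₀ hn]
  · simp

theorem rankOne_mul_rankOne
    (hmul : ∀ k l p q, e k l * e p q = if l = p then e k q else 0) (z : Circle) (g h : ZMod n) :
    rankOne e (ZMod.toCircle g * z) * rankOne e (ZMod.toCircle h * z) =
      if g = h then rankOne e (ZMod.toCircle g * z) else 0 := by
  have := rankOne_mul_rankOne_toCircle_mul hmul (ZMod.toCircle g * z) (h - g)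
  rw [← mul_assoc, ← AddChar.map_add_eq_mul, sub_add_cancel] at this
  rw [this]
  exact if_congr (sub_eq_zero.trans eq_comm) rfl rfl

theorem sum_rankOne (hsum : ∑ k, e k k = 1) (z : Circle) :
    ∑ g : ZMod n, rankOne e (ZMod.toCircle g * z) = 1 := by
  have hn : (n : ℂ) ≠ 0 := NeZero.ne _
  simp only [rankOne]
  rw [← Finset.smul_sum, Finset.sum_comm]
  have h1 : ∀ k : ZMod n, ∑ g : ZMod n, ∑ l : ZMod n,
      (((ZMod.toCircle g * z) ^ (k.val - l.val : ℤ) : Circle) : ℂ) • e k l = (n : ℂ) • e k k := by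
    intro k
    rw [Finset.sum_comm, Finset.sum_eq_single k]
    · simp [← Nat.cast_smul_eq_nsmul ℂ]
    · intro l _ hlk
      simp_rw [mul_zpow, Circle.coe_mul, mul_smul]
      rw [← Finset.sum_smul, sum_toCircle_zpow, if_neg, zero_smul]
      -- As `c` need not be a root of unity, exponents are differences of representatives in `[0,
      -- n)`; such a difference divisible by `n` is zero.
      intro hd
      have h2 := Int.eq_zero_of_abs_lt_dvd hd (by
        have := ZMod.val_lt k
        have := ZMod.val_lt l
        rw [abs_lt]
        omega)
      exact hlk (ZMod.val_injective n (by omega))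
    · simp
  simp_rw [h1]
  rw [← Finset.smul_sum, hsum, inv_smul_smul₀ hn]

theorem norm_rankOne_commutator_le (c : Circle) (a : A) {δ : ℝ}
    (h : ∀ k l, ‖e k l * a - a * e k l‖ ≤ δ) :
    ‖rankOne e c * a - a * rankOne e c‖ ≤ n * δ := by
  have h1 : rankOne e c * a - a * rankOne e c = (n : ℂ)⁻¹ • ∑ k, ∑ l,
      ((c ^ (k.val - l.val : ℤ) : Circle) : ℂ) • (e k l * a - a * e k l) := by
    simp only [rankOne, smul_mul_assoc, mul_smul_comm, Finset.sum_mul, Finset.mul_sum, smul_sub,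
      Finset.sum_sub_distrib]
  have hn : (0 : ℝ) < n := Nat.cast_pos.2 (NeZero.pos n)
  rw [h1, norm_smul, norm_inv, Complex.norm_natCast, inv_mul_le_iff₀ hn]
  have h2 : ∀ k, ‖∑ l, ((c ^ (k.val - l.val : ℤ) : Circle) : ℂ) • (e k l * a - a * e k l)‖ ≤
      n * δ := by
    intro k
    refine (norm_sum_le_of_le Finset.univ (n := fun _ => δ) fun l _ => ?_).trans_eq (by simp)
    rw [norm_smul, Circle.norm_coe, one_mul]
    exact h k l
  exact (norm_sum_le_of_le Finset.univ fun k _ => h2 k).trans_eq (by simp)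

end RankOne

/-! ### Equivariant projections over the circle and the Rokhlin net -/

section Rokhlin

variable {A : Type*} [CStarAlgebra A]

theorem eventually_commutator_le_of_isCompact {T : ℕ → A} (hT : ∀ m, ‖T m‖ ≤ 1)
    (h : ∀ a, Tendsto (fun m => T m * a - a * T m) atTop (𝓝 0)) {K : Set A} (hK : IsCompact K)
    {δ : ℝ} (hδ : 0 < δ) : ∀ᶠ m in atTop, ∀ a ∈ K, ‖T m * a - a * T m‖ ≤ δ := by
  obtain ⟨t, -, ht, hKt⟩ := hK.finite_cover_balls (e := δ / 4) (by positivity)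
  have h1 : ∀ᶠ m in atTop, ∀ b ∈ t, ‖T m * b - b * T m‖ ≤ δ / 2 :=
    (eventually_all_finite ht).2 fun b _ => (h b).norm.eventually_le_const
      (by simpa using half_pos hδ : ‖(0 : A)‖ < δ / 2)
  filter_upwards [h1] with m hm a ha
  obtain ⟨b, hb, hab⟩ := Set.mem_iUnion₂.1 (hKt ha)
  rw [Metric.mem_ball, dist_eq_norm] at hab
  have e1 : T m * a - a * T m = T m * (a - b) - (a - b) * T m + (T m * b - b * T m) := by
    noncomm_ring
  have h2 : ‖T m * (a - b)‖ ≤ 1 * (δ / 4) := norm_mul_le_of_le (hT m) hab.le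
  have h3 : ‖(a - b) * T m‖ ≤ δ / 4 * 1 := norm_mul_le_of_le hab.le (hT m)
  rw [e1]
  linarith [norm_add_le (T m * (a - b) - (a - b) * T m) (T m * b - b * T m),
    norm_sub_le (T m * (a - b)) ((a - b) * T m), hm b hb]

/-- Continuous families of partitions of unity into projections, equivariant for the action of
`ℤ_n` on the circle and on `A`, and almost commuting with a finite set. -/
theorem exists_equivariant_projections {n : ℕ} [NeZero n] {α : Circle →* (A ≃⋆ₐ[ℂ] A)}
    (hα : IsContinuousAction α) (hA : AbsorbsUHF n A) (F : Finset A) {δ : ℝ} (hδ : 0 < δ) :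
    ∃ f : ZMod n → Circle → A, (∀ g, Continuous (f g)) ∧ (∀ g, star (f g) = f g) ∧
      (∀ g h, f g * f h = if g = h then f g else 0) ∧ ∑ g, f g = 1 ∧
      (∀ g h z, α (ZMod.toCircle g) (f h (ZMod.toCircle g * z)) = f (g + h) z) ∧
      ∀ g z, ∀ a ∈ F, ‖f g z * a - a * f g z‖ ≤ δ := by
  obtain ⟨e, hstar, hmul, hsum, hnorm, hcomm⟩ := hA.exists_matrixUnits
  have hn : (0 : ℝ) < n := Nat.cast_pos.2 (NeZero.pos n)
  -- Commuting `α_{z⁻¹}(P)` with `a` amounts to commuting `P` with `α_z(a)`, so the matrix units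
  -- must almost commute with the whole compact orbit of `a`.
  have hK : ∀ a : A, IsCompact (Set.range fun z => α z a) := fun a => isCompact_range (hα a)
  have hev : ∀ᶠ m in atTop, ∀ k l, ∀ a ∈ F, ∀ b ∈ Set.range fun z => α z a,
      ‖e m k l * b - b * e m k l‖ ≤ δ / n :=
    eventually_all.2 fun k => eventually_all.2 fun l => (eventually_all_finset F).2 fun a _ =>
      eventually_commutator_le_of_isCompact (fun m => hnorm m k l) (hcomm k l) (hK a)
        (by positivity)
  obtain ⟨m, hm⟩ := hev.exists
  -- Replacing `z` by `ω_g z` contributes `α_{ω_g}⁻¹` outside, cancelled by the action, and `ω_g`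
  -- inside `P`, which shifts the index.
  refine ⟨fun g z => α z⁻¹ (rankOne (e m) (ZMod.toCircle g * z)), fun g => ?_, fun g => ?_,
    fun g h => ?_, ?_, fun g h z => ?_, fun g z a ha => ?_⟩
  · simp only [rankOne, map_smul, map_sum]
    refine Continuous.const_smul (continuous_finsetSum _ fun k _ =>
      continuous_finsetSum _ fun l _ => Continuous.smul ?_ ((hα _).comp continuous_inv)) _
    exact continuous_subtype_val.comp ((continuous_const.mul continuous_id).zpow _)
  · ext z
    simp only [Pi.star_apply, ← map_star, star_rankOne (hstar m)]
  · ext z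
    simp only [Pi.mul_apply, ← map_mul, rankOne_mul_rankOne (hmul m)]
    split_ifs <;> simp
  · ext z
    rw [Finset.sum_apply, ← map_sum, sum_rankOne (hsum m), map_one, Pi.one_apply]
  · change _ = α z⁻¹ (rankOne (e m) (ZMod.toCircle (g + h) * z))
    rw [← StarAlgEquiv.mul_apply, ← map_mul, mul_inv_rev, ← mul_assoc, mul_comm (ZMod.toCircle g) z⁻¹,
      mul_inv_cancel_right, AddChar.map_add_eq_mul, mul_comm (ZMod.toCircle g) (ZMod.toCircle h),
      mul_assoc (ZMod.toCircle h)]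
  · have h1 : α z⁻¹ (α z a) = a := by
      rw [← StarAlgEquiv.mul_apply, ← map_mul, inv_mul_cancel, map_one]; rfl
    have h2 := norm_rankOne_commutator_le (e := e m) (ZMod.toCircle g * z) (α z a)
      fun k l => hm k l a ha _ ⟨z, rfl⟩
    rw [mul_div_cancel₀ _ hn.ne'] at h2
    conv_lhs => rw [← h1, ← map_mul, ← map_mul, ← map_sub]
    rwa [StarAlgEquiv.norm_map]

/-- Indexing by finite sets and tolerances turns the Rokhlin property into limits valid for every
element of `A` at once. -/
theorem CircleRokhlin.exists_net {α : Circle →* (A ≃⋆ₐ[ℂ] A)} (hR : CircleRokhlin α) :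
    ∃ u : Finset A × ℕ → unitary A,
      (∀ b : A, Tendsto (fun i => (u i : A) * b - b * u i) atTop (𝓝 0)) ∧
      ∀ ζ : Circle, Tendsto (fun i => α ζ (u i) - (ζ : ℂ) • (u i : A)) atTop (𝓝 0) := by
  classical
  choose v hv hvα hvF using fun i : Finset A × ℕ =>
    hR i.1 (1 / ((i.2 : ℝ) + 1)) Nat.one_div_pos_of_nat
  have ht : Tendsto (fun i : Finset A × ℕ => 1 / ((i.2 : ℝ) + 1)) atTop (𝓝 0) := by
    rw [← prod_atTop_atTop_eq]
    exact tendsto_one_div_add_atTop_nhds_zero_nat.comp tendsto_snd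
  refine ⟨fun i => ⟨v i, hv i⟩, fun b => ?_, fun ζ => ?_⟩
  · refine squeeze_zero_norm' ?_ ht
    filter_upwards [eventually_ge_atTop ({b}, 0)] with i hi
    exact (hvF i b (hi.1 (Finset.mem_singleton_self b))).le
  · exact squeeze_zero_norm (fun i => (hvα i ζ).le) ht

end Rokhlin

/-! ### Transfer of the projections to the algebra -/

theorem HasSymbol.sub {A ι : Type*} [CStarAlgebra A] {l : Filter ι} {u : ι → unitary A}
    (hu : ∀ b : A, Tendsto (fun i => (u i : A) * b - b * u i) l (𝓝 0))
    {f g : Circle → A} {X Y : ι → A} (hf : HasSymbol l u f X) (hg : HasSymbol l u g Y) :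
    HasSymbol l u (f - g) (X - Y) := by
  convert hf.add ((HasSymbol.const (-1)).mul hu hg) using 1 <;> ext <;> simp [sub_eq_add_neg]

/-- Each `f_g` is replaced by a trigonometric polynomial within `η`. The exact relations of the
`f_g` become pointwise bounds for combinations of symbols, and asymptotic contractivity carries
these to `A` at the cost of one further `η`. -/
theorem exists_almost_projections {A : Type*} [CStarAlgebra A] {n : ℕ} [NeZero n]
    {α : Circle →* (A ≃⋆ₐ[ℂ] A)} (hα : IsContinuousAction α) (hR : CircleRokhlin α)
    (hA : AbsorbsUHF n A) (F : Finset A) {η : ℝ} (hη : 0 < η) (hη1 : η ≤ 1) :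
    ∃ E : ZMod n → A, (∀ g, ‖E g‖ ≤ 3) ∧
      (∀ g h, ‖E g * E h - if g = h then E g else 0‖ ≤ 5 * η) ∧
      (∀ g, ‖star (E g) - E g‖ ≤ 3 * η) ∧ ‖∑ g, E g - 1‖ ≤ (n + 1) * η ∧
      (∀ g h, ‖α (ZMod.toCircle g) (E h) - E (g + h)‖ ≤ 3 * η) ∧
      ∀ g, ∀ a ∈ F, ‖E g * a - a * E g‖ ≤ (2 * ‖a‖ + 2) * η := by
  classical
  obtain ⟨f, hfc, hfs, hfm, hf1, hfα, hfF⟩ := exists_equivariant_projections hα hA F hη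
  obtain ⟨u, hu, huα⟩ := hR.exists_net
  choose p X hpX hp using fun g => exists_hasSymbol atTop u (hfc g) hη
  have hfn : ∀ g z, ‖f g z‖ ≤ 1 := by
    intro g z
    have h1 := CStarRing.norm_star_mul_self (x := f g z)
    rw [← Pi.star_apply, hfs, ← Pi.mul_apply, hfm, if_pos rfl] at h1
    nlinarith [norm_nonneg (f g z)]
  have hpf : ∀ g z, ‖p g z - f g z‖ ≤ η := fun g z => by rw [norm_sub_rev]; exact hp g z
  have hpn : ∀ g z, ‖p g z‖ ≤ 1 + η := by
    intro g z
    simpa using norm_add_le_of_le (hfn g z) (hpf g z)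
  have h1 : ∀ g, ∀ᶠ i in atTop, ‖X g i‖ ≤ 3 := by
    intro g
    filter_upwards [(hpX g).eventually_norm_le hu (hpn g) hη] with i hi
    linarith
  have h2 : ∀ g h, ∀ᶠ i in atTop, ‖X g i * X h i - if g = h then X g i else 0‖ ≤ 5 * η := by
    intro g h
    have hs : HasSymbol atTop u (p g * p h - if g = h then p g else 0)
        (X g * X h - if g = h then X g else 0) := by
      refine ((hpX g).mul hu (hpX h)).sub hu ?_
      split_ifs
      · exact hpX g
      · exact HasSymbol.const 0
    -- The three replacement errors total `η(1 + η) + η + η`, at most `4η` because `η ≤ 1`.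
    have hb : ∀ z, ‖(p g * p h - if g = h then p g else 0) z‖ ≤ 4 * η := by
      intro z
      have e0 : f g z * f h z = if g = h then f g z else 0 := by
        rw [← Pi.mul_apply, hfm]; split_ifs <;> rfl
      have e1 : (p g * p h - if g = h then p g else 0) z = (p g z - f g z) * p h z +
          f g z * (p h z - f h z) - (if g = h then p g z - f g z else 0) := by
        split_ifs with hgh
        · simp only [Pi.sub_apply, Pi.mul_apply, mul_sub, sub_mul, e0, if_pos hgh]
          abel
        · simp only [Pi.sub_apply, Pi.mul_apply, mul_sub, sub_mul, e0, if_neg hgh, Pi.zero_apply]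
          abel
      have e2 : ‖if g = h then p g z - f g z else 0‖ ≤ η := by
        split_ifs
        · exact hpf g z
        · simpa using hη.le
      have e3 := norm_mul_le_of_le (hpf g z) (hpn h z)
      have e4 := norm_mul_le_of_le (hfn g z) (hpf h z)
      rw [e1]
      refine (norm_sub_le_of_le (norm_add_le_of_le e3 e4) e2).trans ?_
      nlinarith
    filter_upwards [hs.eventually_norm_le hu hb hη] with i hi
    have e5 : (X g * X h - if g = h then X g else 0) i =
        X g i * X h i - if g = h then X g i else 0 := by
      split_ifs <;> rfl
    rw [e5] at hi
    linarith
  have h3 : ∀ g, ∀ᶠ i in atTop, ‖star (X g i) - X g i‖ ≤ 3 * η := by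
    intro g
    have hb : ∀ z, ‖(star (p g) - p g) z‖ ≤ 2 * η := by
      intro z
      have e1 : (star (p g) - p g) z = star (p g z - f g z) - (p g z - f g z) := by
        rw [star_sub, ← Pi.star_apply (f g), hfs]
        simp
      rw [e1]
      refine (norm_sub_le_of_le ((norm_star _).trans_le (hpf g z)) (hpf g z)).trans ?_
      linarith
    filter_upwards [(((hpX g).star hu).sub hu (hpX g)).eventually_norm_le hu hb hη] with i hi
    exact hi.trans (by linarith)
  have h4 : ∀ᶠ i in atTop, ‖∑ g, X g i - 1‖ ≤ (n + 1) * η := by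
    have hb : ∀ z, ‖((∑ g, p g) - fun _ => 1 : Circle → A) z‖ ≤ n * η := by
      intro z
      have e1 : ((∑ g, p g) - fun _ => 1 : Circle → A) z = ∑ g, (p g z - f g z) := by
        rw [Finset.sum_sub_distrib, ← Finset.sum_apply z _ f, hf1]
        simp
      rw [e1]
      exact (norm_sum_le_of_le _ fun g _ => hpf g z).trans_eq (by simp)
    filter_upwards [((HasSymbol.sum Finset.univ fun g _ => hpX g).sub hu
      (HasSymbol.const 1)).eventually_norm_le hu hb hη] with i hi
    rw [Pi.sub_apply, Finset.sum_apply] at hi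
    linarith
  have h5 : ∀ g h, ∀ᶠ i in atTop, ‖α (ZMod.toCircle g) (X h i) - X (g + h) i‖ ≤ 3 * η := by
    intro g h
    have hb : ∀ z, ‖((fun z => α (ZMod.toCircle g) (p h (ZMod.toCircle g * z))) - p (g + h)) z‖ ≤
        2 * η := by
      intro z
      have e1 : ((fun z => α (ZMod.toCircle g) (p h (ZMod.toCircle g * z))) - p (g + h)) z =
          α (ZMod.toCircle g) (p h (ZMod.toCircle g * z) - f h (ZMod.toCircle g * z)) -
            (p (g + h) z - f (g + h) z) := by
        rw [map_sub, hfα, Pi.sub_apply]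
        abel
      rw [e1]
      refine (norm_sub_le_of_le ((StarAlgEquiv.norm_map _ _).trans_le (hpf h _))
        (hpf (g + h) z)).trans ?_
      linarith
    filter_upwards [(((hpX h).map (huα (ZMod.toCircle g))).sub hu
      (hpX (g + h))).eventually_norm_le hu hb hη] with i hi
    exact hi.trans (by linarith)
  have h6 : ∀ g, ∀ a ∈ F, ∀ᶠ i in atTop, ‖X g i * a - a * X g i‖ ≤ (2 * ‖a‖ + 2) * η := by
    intro g a ha
    have hb : ∀ z, ‖((p g * fun _ => a) - (fun _ => a) * p g : Circle → A) z‖ ≤ (2 * ‖a‖ + 1) * η := by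
      intro z
      have e1 : ((p g * fun _ => a) - (fun _ => a) * p g : Circle → A) z = (p g z - f g z) * a -
          a * (p g z - f g z) + (f g z * a - a * f g z) := by
        simp only [Pi.sub_apply, Pi.mul_apply]
        noncomm_ring
      rw [e1]
      refine (norm_add_le_of_le (norm_sub_le_of_le (norm_mul_le_of_le (hpf g z) le_rfl)
        (norm_mul_le_of_le le_rfl (hpf g z))) (hfF g z a ha)).trans ?_
      linarith
    filter_upwards [(((hpX g).mul hu (HasSymbol.const a)).sub hu
      ((HasSymbol.const a).mul hu (hpX g))).eventually_norm_le hu hb hη] with i hi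
    exact hi.trans (by linarith)
  obtain ⟨i, hi1, hi2, hi3, hi4, hi5, hi6⟩ := ((eventually_all.2 h1).and
    ((eventually_all.2 fun g => eventually_all.2 fun h => h2 g h).and
    ((eventually_all.2 h3).and (h4.and
    ((eventually_all.2 fun g => eventually_all.2 fun h => h5 g h).and
    (eventually_all.2 fun g => (eventually_all_finset F).2 fun a ha => h6 g a ha)))))).exists
  exact ⟨fun g => X g i, hi1, hi2, hi3, hi4, hi5, hi6⟩

end RokhlinCircle

end

/-! ### Conclusion -/

open Filter Topology RokhlinCircle in
theorem mainTheorem3 {A : Type*} [CStarAlgebra A] [TopologicalSpace.SeparableSpace A]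
    (n : ℕ) [NeZero n] (α : Circle →* (A ≃⋆ₐ[ℂ] A))
    (hα : RokhlinCircle.IsContinuousAction α) (hR : RokhlinCircle.CircleRokhlin α)
    (hA : RokhlinCircle.AbsorbsUHF n A) :
    RokhlinCircle.FiniteRokhlin (RokhlinCircle.restrictCyclic α n) := by
  intro F ε hε
  have hη : ∀ m : ℕ, 0 < 1 / ((m : ℝ) + 1) := fun m => Nat.one_div_pos_of_nat
  have hη1 : ∀ m : ℕ, 1 / ((m : ℝ) + 1) ≤ 1 := fun m => by
    rw [div_le_one (by positivity)]
    linarith [(m.cast_nonneg : (0 : ℝ) ≤ m)]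
  choose E hE hmul hstar hsum hact hcomm using fun m : ℕ =>
    exists_almost_projections hα hR hA F (hη m) (hη1 m)
  have ht : ∀ c : ℝ, Tendsto (fun m : ℕ => c * (1 / ((m : ℝ) + 1))) atTop (𝓝 0) := fun c => by
    simpa using tendsto_one_div_add_atTop_nhds_zero_nat.const_mul c
  set C : ℝ := ∑ a ∈ F, ‖a‖ with hC
  have hC0 : 0 ≤ C := Finset.sum_nonneg fun a _ => norm_nonneg a
  have hC1 : ∀ a ∈ F, ‖a‖ ≤ C := fun a ha =>
    Finset.single_le_sum (f := fun a : A => ‖a‖) (fun a _ => norm_nonneg a) ha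
  -- Chosen so that `δ ≤ ε/4` and `2Cδ ≤ ε/2`: correcting to exact projections then costs at most
  -- `ε/2`, and the almost projections add at most `ε/4`.
  set δ := ε / (4 * (C + 1)) with hδ
  have hδ0 : 0 < δ := by positivity
  have hδ1 : δ * (C + 1) = ε / 4 := by rw [hδ]; field_simp
  have hδ2 : δ ≤ ε / 4 := by nlinarith
  have hproj := eventually_exists_isStarProjection (l := atTop) (E := fun g m => E m g)
    (fun g => isBoundedUnder_of ⟨3, fun m => hE m g⟩)
    (fun g h => squeeze_zero_norm (fun m => hmul m g h) (ht 5))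
    (fun g => squeeze_zero_norm (fun m => hstar m g) (ht 3))
    (squeeze_zero_norm hsum (ht (n + 1))) hδ0
  obtain ⟨m, ⟨e, he1, he2, he3, he4⟩, hm1, hm2⟩ := (hproj.and
    (((ht 3).eventually_le_const (by positivity : 0 < ε / 4)).and
      ((ht (2 * C + 2)).eventually_le_const (by positivity : 0 < ε / 4)))).exists
  refine ⟨fun g => e g.toAdd, fun g => he1 _, fun g h hgh => he2 _ _ fun hc => hgh hc,
    fun g h => ?_, fun g a ha => ?_, ?_⟩
  · have e1 : restrictCyclic α n g (e h.toAdd) - e (g * h).toAdd =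
        α (ZMod.toCircle g.toAdd) (e h.toAdd - E m h.toAdd) +
        (α (ZMod.toCircle g.toAdd) (E m h.toAdd) - E m (g.toAdd + h.toAdd)) -
        (e (g.toAdd + h.toAdd) - E m (g.toAdd + h.toAdd)) := by
      change α (ZMod.toCircle g.toAdd) (e h.toAdd) - e (g.toAdd + h.toAdd) = _
      rw [map_sub]
      abel
    rw [e1]
    refine (norm_sub_le_of_le (norm_add_le_of_le ((StarAlgEquiv.norm_map _ _).trans_le (he4 _))
      (hact m _ _)) (he4 _)).trans_lt ?_
    linarith
  · have e1 : e g.toAdd * a - a * e g.toAdd = (e g.toAdd - E m g.toAdd) * a -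
        a * (e g.toAdd - E m g.toAdd) + (E m g.toAdd * a - a * E m g.toAdd) := by
      noncomm_ring
    rw [e1]
    refine (norm_add_le_of_le (norm_sub_le_of_le (norm_mul_le_of_le (he4 _) (hC1 a ha))
      (norm_mul_le_of_le (hC1 a ha) (he4 _))) (hcomm m _ a ha)).trans_lt ?_
    have h1 : (2 * ‖a‖ + 2) * (1 / ((m : ℝ) + 1)) ≤ (2 * C + 2) * (1 / ((m : ℝ) + 1)) :=
      mul_le_mul_of_nonneg_right (by linarith [hC1 a ha]) (hη m).le
    nlinarith
  · exact (Multiplicative.toAdd.sum_comp e).trans he3
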